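/- Let $N\in\mathbb{N}$ and let $(X,\|\cdot\|)$ be a real normed space of dimension $N$ with a basis $(e_i)_1^N$ such that $\|\sum_i a_{\tau(i)}e_i\|=\|\sum_i a_ie_i\|$ for all $a\in\mathbb{R}^N$ and all permutations $\tau$ of $\{1,\dots,N\}$. Let $K$ be its basis constant, i.e. the smallest $K\ge 1$ such that $\|\sum_{i=1}^{j}a_ie_i\|\le K\|\sum_{i=1}^{N}a_ie_i\|$ for all $a\in\mathbb{R}^N$ and $j\le N$. There is a universal constant $c>0$, and $c=1/100$ works, such that the following holds whenever $0<\varepsilon<(2K)^{-1}$, $n\in\mathbb{N}$ and $$6\le n\le c\,(\log\varepsilon^{-1})^{-1}\log N .$$ Put $\delta=\varepsilon/1429$, $\sigma=\delta^{-4}$, $\alpha=2\delta^{-4}(\log\delta^{-1})^{1/2}$. Let $|\cdot|$ be the Euclidean norm and $\Phi$ the standard normal distribution function. For $x\in\mathbb{Z}^n$ with $|x|\le\alpha\sqrt n$ let $$m(x)=\Big\lfloor N\prod_{i=1}^n\Big(\Phi\Big(\frac{x_i+1/2}{\sigma}\Big)-\Phi\Big(\frac{x_i-1/2}{\sigma}\Big)\Big)\Big\rfloor,\qquad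 N'=\sum_{x\in\mathbb{Z}^n,\ |x|\le\alpha\sqrt n}m(x),$$ and let $m'(x)=m(x)$ for $x\ne0$ and $m'(0)=m(0)+N-N'$. Let $T$ be the $N\times n$ matrix (unique up to the order of its rows) in which, for every $x\in\mathbb{Z}^n$ with $|x|\le\alpha\sqrt n$, the vector $x'=\sqrt n\,x/|x|$ (with $0'=0$) is repeated $m'(x)$ times as a row. Let $\Phi_n(t)=\mathbb{P}\{\sqrt n\,G_1/|G|\le t\}$, where $G$ is a standard Gaussian vector in $\mathbb{R}^n$, let $b=\Phi_n((1-17\delta)\sqrt n)$, define $v\in\mathbb{R}^N$ by $$v_i=\begin{cases}-\sqrt n, & 0\le i-\tfrac12<(1-b)N,\\ \Phi_n^{-1}\big((i-\tfrac12)/N\big), & (1-b)N\le i-\tfrac12\le bN,\\ \sqrt n, & bN<i-\tfrac12\le N,\end{cases}$$ and let $M=\|\sum_i v_ie_i\|$. Then such a matrix $T$ exists (that is, $N'\le N$), and for every such $T$ and all $x\in\mathbb{R}^n$, $$(1-K\varepsilon)M|x|\le\Big\|\sum_{i=1}^N\sum_{j=1}^nT_{i,j}x_je_i\Big\|\le(1+K\varepsilon)M|x|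 .$$ The same inequalities hold, for every $k\le n$ and all $x\in\mathbb{R}^k$, with $T$ replaced by the matrix of its first $k$ columns; in particular, $n=6$ yields embeddings of $\ell_2^k$ for $k<6$. -/

import Mathlib

noncomputable section

namespace EuclideanEmbedding

open MeasureTheory ProbabilityTheory

/-- The norm of `∑ aᵢ eᵢ` is invariant under permutations of the coordinates. -/
def PermInvariant {N : ℕ} {X : Type*} [NormedAddCommGroup X] [NormedSpace ℝ X]
    (e : Module.Basis (Fin N) ℝ X) : Prop :=
  ∀ (a : Fin N → ℝ) (τ : Equiv.Perm (Fin N)), ‖∑ i, a (τ i) • e i‖ = ‖∑ i, a i • e i‖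

/-- `K` is the basis constant of `e`: the smallest `K ≥ 1` such that every initial partial sum
(the first `j` terms) of `∑ aᵢ eᵢ` has norm at most `K ‖∑ aᵢ eᵢ‖`. -/
def IsBasisConstant {N : ℕ} {X : Type*} [NormedAddCommGroup X] [NormedSpace ℝ X]
    (e : Module.Basis (Fin N) ℝ X) (K : ℝ) : Prop :=
  IsLeast {C : ℝ | 1 ≤ C ∧ ∀ (a : Fin N → ℝ) (j : ℕ), j ≤ N →
    ‖∑ i with i.val < j, a i • e i‖ ≤ C * ‖∑ i, a i • e i‖} K

/-- The Euclidean norm of a real vector. -/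
def enorm₂ {n : ℕ} (x : Fin n → ℝ) : ℝ := √(∑ i, x i ^ 2)

/-- The parameter `δ = ε / 1429`. -/
def delta (ε : ℝ) : ℝ := ε / 1429

/-- The parameter `σ = δ⁻⁴`. -/
def sigma (ε : ℝ) : ℝ := (delta ε)⁻¹ ^ 4

/-- The parameter `α = 2 δ⁻⁴ (log δ⁻¹)^{1/2}`. -/
def alpha (ε : ℝ) : ℝ := 2 * (delta ε)⁻¹ ^ 4 * √(Real.log (delta ε)⁻¹)

/-- The standard normal cumulative distribution function `Φ`. -/
def Phi (t : ℝ) : ℝ := cdf (gaussianReal 0 1) t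

/-- The integer points `x` of `ℤⁿ` with `|x| ≤ r`; see `mem_latticeBall`. -/
def latticeBall (n : ℕ) (r : ℝ) : Finset (Fin n → ℤ) :=
  (Fintype.piFinset fun _ : Fin n => Finset.Icc (-⌈r⌉) ⌈r⌉).filter
    fun x => enorm₂ (fun i => (x i : ℝ)) ≤ r

theorem mem_latticeBall {n : ℕ} {r : ℝ} {x : Fin n → ℤ} :
    x ∈ latticeBall n r ↔ enorm₂ (fun i => (x i : ℝ)) ≤ r := by
  simp only [latticeBall, Finset.mem_filter, Fintype.mem_piFinset, Finset.mem_Icc,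
    and_iff_right_iff_imp]
  intro h i
  have h1 : |(x i : ℝ)| ≤ enorm₂ (fun i => (x i : ℝ)) :=
    Real.abs_le_sqrt
      (Finset.single_le_sum (f := fun i => (x i : ℝ) ^ 2) (fun j _ => sq_nonneg _)
        (Finset.mem_univ i))
  have h2 : |(x i : ℝ)| ≤ (⌈r⌉ : ℝ) := (h1.trans h).trans (Int.le_ceil r)
  have h3 := abs_le.mp h2
  exact ⟨by exact_mod_cast h3.1, by exact_mod_cast h3.2⟩

/-- The integer points of `α √n B₂ⁿ`. -/
def points (n : ℕ) (ε : ℝ) : Finset (Fin n → ℤ) := latticeBall n (alpha ε * √(n : ℝ))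

/-- The multiplicity `m(x)`: the integer part of `N` times the standard Gaussian measure of the
cube of side `1/σ` centred at `x/σ`. -/
def mult (N : ℕ) {n : ℕ} (ε : ℝ) (x : Fin n → ℤ) : ℤ :=
  ⌊(N : ℝ) * ∏ i, (Phi (((x i : ℝ) + 1 / 2) / sigma ε) - Phi (((x i : ℝ) - 1 / 2) / sigma ε))⌋

/-- `N' = ∑ m(x)`, over the integer points of `α √n B₂ⁿ`. -/
def totalMult (N n : ℕ) (ε : ℝ) : ℤ := ∑ x ∈ points n ε, mult N ε x

/-- The corrected multiplicity `m'(x)`: the missing `N - N'` is added at the origin. -/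
def mult' (N : ℕ) {n : ℕ} (ε : ℝ) (x : Fin n → ℤ) : ℤ :=
  if x = 0 then mult N ε x + (N : ℤ) - totalMult N n ε else mult N ε x

/-- The radial projection `x' = √n x / |x|` (and `0' = 0`). -/
def proj {n : ℕ} (x : Fin n → ℤ) : Fin n → ℝ :=
  fun j => √(n : ℝ) * (x j : ℝ) / enorm₂ (fun i => (x i : ℝ))

/-- `T` is the `N × n` matrix (determined up to the order of its rows) in which, for each integer
point `x` of `α √n B₂ⁿ`, the vector `x'` is repeated `m'(x)` times as a row: the row with index
`i` is `(p i)'`, where the integer points `p i` take each value `x` exactly `m'(x)` times. -/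
def IsEmbeddingMatrix {N n : ℕ} (ε : ℝ) (T : Matrix (Fin N) (Fin n) ℝ) : Prop :=
  ∃ p : Fin N → (Fin n → ℤ),
    (∀ i, p i ∈ points n ε) ∧
    (∀ x ∈ points n ε, ((Finset.univ.filter fun i => p i = x).card : ℤ) = mult' N ε x) ∧
    ∀ i j, T i j = proj (p i) j

/-- The distribution function `Φₙ(t) = ℙ{√n X₁ / |X| ≤ t}`, for `X` a standard Gaussian vector
in `ℝⁿ`, `n ≥ 1`. -/
def PhiN (n : ℕ) (t : ℝ) : ℝ :=
  if h : 0 < n then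
    (Measure.pi fun _ : Fin n => gaussianReal 0 1).real
      {X : Fin n → ℝ | √(n : ℝ) * X ⟨0, h⟩ / enorm₂ X ≤ t}
  else 0

/-- The inverse `Φₙ⁻¹` on `(0, 1)`, as a quantile function. -/
def PhiNInv (n : ℕ) (s : ℝ) : ℝ := sInf {t : ℝ | s ≤ PhiN n t}

/-- `b = Φₙ((1 - 17 δ) √n)`. -/
def bParam (n : ℕ) (ε : ℝ) : ℝ := PhiN n ((1 - 17 * delta ε) * √(n : ℝ))

/-- The vector `v` of quantiles of `Φₙ`, truncated to `±√n` in the tails. The 1-based index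
of `i : Fin N` is `i + 1`, so that the midpoint "index minus one half" is `i + 1/2`. -/
def vVec (N n : ℕ) (ε : ℝ) (i : Fin N) : ℝ :=
  if (i : ℝ) + 1 / 2 < (1 - bParam n ε) * N then -√(n : ℝ)
  else if (i : ℝ) + 1 / 2 ≤ bParam n ε * N then PhiNInv n (((i : ℝ) + 1 / 2) / N)
  else √(n : ℝ)

/-- `M = ‖v‖`, where `v` is identified with `∑ vᵢ eᵢ`. -/
def MConst {N : ℕ} {X : Type*} [NormedAddCommGroup X] [NormedSpace ℝ X]
    (e : Module.Basis (Fin N) ℝ X) (n : ℕ) (ε : ℝ) : ℝ :=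
  ‖∑ i, vVec N n ε i • e i‖

end EuclideanEmbedding

end

noncomputable section

namespace EuclideanEmbedding

open MeasureTheory ProbabilityTheory

/-! By homogeneity it suffices to treat a unit vector `θ`. The coordinates of `Tθ` are the values of
`θ` on the rows, and permutation invariance allows them to be sorted. The rows sample the law of `√n
G/|G|`, whose one-dimensional marginals do not depend on `θ`; so the sorted vector should be close
to the fixed quantile vector `v`, and its norm close to `M`.

The quantitative form is `abs_sort_sub_vVec_le`: coordinatewise, the sorted vector differs from `v`
by at most `21δ(1+|v_i|)`. This mixed absolute and relative error is what the norm tolerates: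
`norm_sum_sub_le` bounds the change of norm by `2·21δ·(1+33)·K M = 1428 δ K M`, hence `δ = ε/1429`.
The term `33` enters through `sum_max_vVec_ge`, which says that `v` has positive parts averaging at
least `1/33`, so that sums of basis vectors are controlled by `M`.

Closeness of quantiles follows from comparison of tails, `card_lt_sum_proj_le`: the proportion of
rows above the level `t+4δ(1+|t|)` is at most the exact spherical tail at `t`. Rows are roundings of
a Gaussian vector, projected to the sphere. Rounding changes the inner product with `θ` by a sum of
independent centred bounded terms, so Hoeffding's bound is free of dimension
(`gaussPi_sum_roundErr_ge_le`). The remaining losses (Gaussian norm too small, lattice point outside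
the ball, integer parts) cost at most `(2δ)^n` each. All of them are absorbed by the mass of the
sector between the levels `t` and `t+2δ(1+|t|)`, bounded below in `gaussPi_sector_ge_of_unit`;
`error_terms_le` does the accounting. Truncation at `(1-17δ)√n` keeps this sector away from the
pole, where its mass would be too small. Lower tails follow by replacing `θ` with `-θ`. -/

/-! ### Stability of the norm under coordinatewise perturbation. -/

/-- A convex function on the cube is largest at a vertex. The induction moves one coordinate at a
time to `0` or `1`; `A` records the coordinates already set to `1`. -/
theorem norm_sum_smul_le_of_forall_subset {ι X : Type*} [Fintype ι] [NormedAddCommGroup X]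
    [NormedSpace ℝ X] {f : ι → X} {C : ℝ} (hC : ∀ A : Finset ι, ‖∑ i ∈ A, f i‖ ≤ C)
    {μ : ι → ℝ} (h0 : ∀ i, 0 ≤ μ i) (h1 : ∀ i, μ i ≤ 1) : ‖∑ i, μ i • f i‖ ≤ C := by
  classical
  have key : ∀ s A : Finset ι, Disjoint A s → ‖∑ i ∈ A, f i + ∑ i ∈ s, μ i • f i‖ ≤ C := by
    intro s
    induction s using Finset.induction_on with
    | empty => intro A _; simpa using hC A
    | insert j s hj ih =>
      intro A hA
      rw [Finset.disjoint_insert_right] at hA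
      have hd : Disjoint (insert j A) s := by
        rw [Finset.disjoint_insert_left]; exact ⟨hj, hA.2⟩
      have e1 : ∑ i ∈ A, f i + ∑ i ∈ insert j s, μ i • f i
          = (1 - μ j) • (∑ i ∈ A, f i + ∑ i ∈ s, μ i • f i)
            + μ j • (∑ i ∈ insert j A, f i + ∑ i ∈ s, μ i • f i) := by
        rw [Finset.sum_insert hj, Finset.sum_insert hA.1]
        module
      rw [e1]
      refine (norm_add_le _ _).trans ?_
      rw [norm_smul, norm_smul, Real.norm_of_nonneg (h0 j),
        Real.norm_of_nonneg (sub_nonneg.2 (h1 j))]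
      nlinarith [ih A hA.2, ih _ hd, h0 j, h1 j]
  simpa using key Finset.univ ∅ (by simp)

theorem norm_sum_smul_le_two_mul {ι X : Type*} [Fintype ι] [NormedAddCommGroup X]
    [NormedSpace ℝ X] {f : ι → X} {C : ℝ} (hC : ∀ A : Finset ι, ‖∑ i ∈ A, f i‖ ≤ C)
    {μ : ι → ℝ} (h : ∀ i, |μ i| ≤ 1) : ‖∑ i, μ i • f i‖ ≤ 2 * C := by
  have e1 : ∑ i, μ i • f i = ∑ i, max (μ i) 0 • f i - ∑ i, max (-μ i) 0 • f i := by
    rw [← Finset.sum_sub_distrib]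
    refine Finset.sum_congr rfl fun i _ => ?_
    rw [← sub_smul, max_zero_sub_eq_self]
  rw [e1]
  refine (norm_sub_le _ _).trans ?_
  have h1 := norm_sum_smul_le_of_forall_subset hC (μ := fun i => max (μ i) 0)
    (fun i => le_max_right _ _) (fun i => max_le ((le_abs_self _).trans (h i)) zero_le_one)
  have h2 := norm_sum_smul_le_of_forall_subset hC (μ := fun i => max (-μ i) 0)
    (fun i => le_max_right _ _) (fun i => max_le ((neg_le_abs _).trans (h i)) zero_le_one)
  linarith

section Basis

variable {N : ℕ} {X : Type*} [NormedAddCommGroup X] [NormedSpace ℝ X]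
  {e : Module.Basis (Fin N) ℝ X} {K : ℝ}

/-- A permutation carries `A` to an initial segment, where the basis constant applies. -/
theorem norm_sum_subset_le (hperm : PermInvariant e) (hK : IsBasisConstant e K)
    (a : Fin N → ℝ) (A : Finset (Fin N)) :
    ‖∑ i ∈ A, a i • e i‖ ≤ K * ‖∑ i, a i • e i‖ := by
  classical
  have hle : A.card ≤ N := by simpa using Finset.card_le_univ A
  have hcard : Fintype.card {i : Fin N // i.val < A.card} = Fintype.card {i : Fin N // i ∈ A} := by
    rw [Fintype.card_coe, Fintype.card_fin_lt_of_le hle]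
  set τ : Equiv.Perm (Fin N) := (Fintype.equivOfCardEq hcard).extendSubtype with hτ
  have hmem : ∀ i : Fin N, τ i ∈ A ↔ i.val < A.card := by
    intro i
    constructor
    · intro h
      by_contra h'
      exact Equiv.extendSubtype_not_mem (Fintype.equivOfCardEq hcard) i h' h
    · intro h
      exact Equiv.extendSubtype_mem (Fintype.equivOfCardEq hcard) i h
  have h1 := hperm (fun i => if i ∈ A then a i else 0) τ
  have h2 := hperm a τ
  have h3 := hK.1.2 (fun i => a (τ i)) A.card hle
  simp only [hmem, ite_smul, zero_smul, ← Finset.sum_filter] at h1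
  rw [Finset.filter_mem_eq_inter, Finset.univ_inter] at h1
  rw [← h1, ← h2]
  exact h3

/-- Averaging over cyclic shifts: each shift of `v`, restricted to the part of `B` where it is
positive, has norm at most `K‖v‖`, and the `N` shifts add up to a multiple of `∑ i ∈ B, e i` whose
coefficient is the sum of the positive parts. -/
theorem norm_sum_basis_subset_le (hperm : PermInvariant e) (hK : IsBasisConstant e K)
    {v : Fin N → ℝ} {m : ℝ} (hm : 0 < m) (hv : m * N ≤ ∑ i, max (v i) 0) (B : Finset (Fin N)) :
    ‖∑ i ∈ B, e i‖ ≤ K * ‖∑ i, v i • e i‖ / m := by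
  classical
  have hKnn : 0 ≤ K := zero_le_one.trans hK.1.1
  rcases Nat.eq_zero_or_pos N with h0 | hN
  · subst h0
    have : B = ∅ := Finset.eq_empty_of_isEmpty B
    subst this
    simp only [Finset.sum_empty, norm_zero]
    positivity
  have : NeZero N := ⟨hN.ne'⟩
  have hshift : ∀ k : Fin N, ‖∑ i ∈ B, max (v (k + i)) 0 • e i‖ ≤ K * ‖∑ i, v i • e i‖ := by
    intro k
    have h1 := norm_sum_subset_le hperm hK (fun i => v (k + i)) (B.filter fun i => 0 < v (k + i))
    have h2 := hperm v (Equiv.addLeft k)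
    simp only [Equiv.coe_addLeft] at h2
    rw [h2, Finset.sum_filter] at h1
    convert h1 using 3
    split_ifs with h
    · rw [max_eq_left h.le]
    · rw [max_eq_right (not_lt.1 h), zero_smul]
  set S : ℝ := ∑ i, max (v i) 0 with hS
  have hsum : ∑ k, ∑ i ∈ B, max (v (k + i)) 0 • e i = S • ∑ i ∈ B, e i := by
    rw [Finset.sum_comm, Finset.smul_sum]
    refine Finset.sum_congr rfl fun i _ => ?_
    rw [← Finset.sum_smul]
    congr 1
    exact Fintype.sum_equiv (Equiv.addRight i) _ _ fun k => rfl
  have hle : ‖S • ∑ i ∈ B, e i‖ ≤ N * (K * ‖∑ i, v i • e i‖) := by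
    rw [← hsum]
    refine (norm_sum_le _ _).trans ((Finset.sum_le_sum fun k _ => hshift k).trans ?_)
    simp
  have hNp : (0 : ℝ) < N := by exact_mod_cast hN
  rw [norm_smul, Real.norm_of_nonneg ((by positivity : (0 : ℝ) ≤ m * N).trans hv)] at hle
  rw [le_div_iff₀ hm]
  have h5 : m * N * ‖∑ i ∈ B, e i‖ ≤ N * (K * ‖∑ i, v i • e i‖) :=
    (mul_le_mul_of_nonneg_right hv (norm_nonneg _)).trans hle
  refine le_of_mul_le_mul_left ?_ hNp
  linarith

theorem norm_sum_sub_le (hperm : PermInvariant e) (hK : IsBasisConstant e K)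
    {v w : Fin N → ℝ} {m h : ℝ} (hm : 0 < m) (hv : m * N ≤ ∑ i, max (v i) 0)
    (hh : 0 ≤ h) (hw : ∀ i, |w i - v i| ≤ h * (1 + |v i|)) :
    ‖∑ i, w i • e i - ∑ i, v i • e i‖ ≤ 2 * h * (1 + 1 / m) * (K * ‖∑ i, v i • e i‖) := by
  rcases hh.eq_or_lt with rfl | hpos
  · have : w = v := by
      ext i
      have := hw i
      rw [zero_mul] at this
      linarith [abs_eq_zero.1 (le_antisymm this (abs_nonneg _))]
    simp [this]
  set μ : Fin N → ℝ := fun i => (w i - v i) / (h * (1 + |v i|)) with hμ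
  have hden : ∀ i, 0 < h * (1 + |v i|) := fun i => by positivity
  have hμ1 : ∀ i, |μ i| ≤ 1 := by
    intro i
    rw [hμ, abs_div, abs_of_pos (hden i), div_le_one (hden i)]
    exact hw i
  -- The absolute part of the error is a bounded multiplier of the basis vectors, the relative part
  -- a bounded multiplier of `v`; each is estimated by its own subset bound.
  have hw' : ∀ i, w i - v i = h * μ i + h * (μ i * SignType.sign (v i) * v i) := by
    intro i
    have : μ i * (h * (1 + |v i|)) = w i - v i := div_mul_cancel₀ _ (hden i).ne'
    rw [← this, mul_assoc (μ i), sign_mul_self]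
    ring
  have hν1 : ∀ i, |μ i * (SignType.sign (v i) : ℝ)| ≤ 1 := by
    intro i
    rw [abs_mul]
    have : |((SignType.sign (v i) : SignType) : ℝ)| ≤ 1 := by
      rcases lt_trichotomy (v i) 0 with h | h | h <;> simp [h]
    nlinarith [hμ1 i, abs_nonneg (μ i), abs_nonneg ((SignType.sign (v i) : SignType) : ℝ)]
  have e1 : ∑ i, w i • e i - ∑ i, v i • e i
      = h • (∑ i, μ i • e i) + h • ∑ i, (μ i * (SignType.sign (v i) : ℝ)) • (v i • e i) := by
    rw [← Finset.sum_sub_distrib, Finset.smul_sum, Finset.smul_sum, ← Finset.sum_add_distrib]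
    refine Finset.sum_congr rfl fun i _ => ?_
    rw [← sub_smul, hw' i, smul_smul, smul_smul, smul_smul, ← add_smul]
    congr 1
    ring
  rw [e1]
  refine (norm_add_le _ _).trans ?_
  rw [norm_smul, norm_smul, Real.norm_of_nonneg hh]
  have b1 := norm_sum_smul_le_two_mul (norm_sum_basis_subset_le hperm hK hm hv) hμ1
  have b2 := norm_sum_smul_le_two_mul (norm_sum_subset_le hperm hK v) hν1
  have : 2 * h * (1 + 1 / m) * (K * ‖∑ i, v i • e i‖)
      = h * (2 * (K * ‖∑ i, v i • e i‖ / m)) + h * (2 * (K * ‖∑ i, v i • e i‖)) := by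
    field_simp
    ring
  rw [this]
  gcongr

end Basis

/-! ### Gaussian integrals and exponential moments. -/

/-- The standard Gaussian measure on `ℝⁿ`. -/
abbrev gaussPi (n : ℕ) : Measure (Fin n → ℝ) := Measure.pi fun _ : Fin n => gaussianReal 0 1

theorem enorm₂_nonneg {n : ℕ} (x : Fin n → ℝ) : 0 ≤ enorm₂ x := Real.sqrt_nonneg _

theorem enorm₂_sq {n : ℕ} (x : Fin n → ℝ) : enorm₂ x ^ 2 = ∑ i, x i ^ 2 :=
  Real.sq_sqrt (Finset.sum_nonneg fun _ _ => sq_nonneg _)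

theorem measurable_enorm₂ {n : ℕ} : Measurable (enorm₂ : (Fin n → ℝ) → ℝ) := by
  unfold enorm₂
  fun_prop

theorem gaussianPDFReal_zero_one (x : ℝ) :
    gaussianPDFReal 0 1 x = (√(2 * Real.pi))⁻¹ * Real.exp (-(1 / 2) * x ^ 2) := by
  rw [gaussianPDFReal]
  simp only [NNReal.coe_one, mul_one, sub_zero]
  congr 2
  ring

theorem integrable_exp_neg_mul_sq_gaussianReal {l : ℝ} (hl : -(1 / 2) < l) :
    Integrable (fun x => Real.exp (-l * x ^ 2)) (gaussianReal 0 1) := by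
  rw [gaussianReal_of_var_ne_zero 0 one_ne_zero, integrable_withDensity_iff
    (measurable_gaussianPDF _ _) (by simp [gaussianPDF_lt_top])]
  simp only [toReal_gaussianPDF, gaussianPDFReal_zero_one]
  refine ((integrable_exp_neg_mul_sq (b := l + 1 / 2) (by linarith)).const_mul
    (√(2 * Real.pi))⁻¹).congr (Filter.Eventually.of_forall fun x => ?_)
  simp only
  rw [mul_left_comm, ← Real.exp_add]
  ring_nf

theorem integral_exp_neg_mul_sq_gaussianReal {l : ℝ} (hl : -(1 / 2) < l) :
    ∫ x, Real.exp (-l * x ^ 2) ∂gaussianReal 0 1 = (√(1 + 2 * l))⁻¹ := by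
  rw [integral_gaussianReal_eq_integral_smul one_ne_zero]
  simp only [gaussianPDFReal_zero_one, smul_eq_mul]
  have : ∀ x : ℝ, (√(2 * Real.pi))⁻¹ * Real.exp (-(1 / 2) * x ^ 2) * Real.exp (-l * x ^ 2)
      = (√(2 * Real.pi))⁻¹ * Real.exp (-(l + 1 / 2) * x ^ 2) := by
    intro x
    rw [mul_assoc, ← Real.exp_add]
    ring_nf
  simp only [this]
  rw [integral_const_mul, integral_gaussian, ← Real.sqrt_inv, ← Real.sqrt_inv,
    ← Real.sqrt_mul (by positivity)]
  congr 1
  have : 0 < 1 + 2 * l := by linarith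
  rw [show l + 1 / 2 = (1 + 2 * l) / 2 by ring]
  field_simp

theorem integrable_abs_mul_exp_neg_mul_sq_gaussianReal {l : ℝ} (hl : 0 ≤ l) :
    Integrable (fun x => |x| * Real.exp (-l * x ^ 2)) (gaussianReal 0 1) := by
  have h1 : Integrable (fun x : ℝ => |x|) (gaussianReal 0 1) := by
    have := (IsGaussian.integrable_id (μ := gaussianReal 0 1)).abs
    simpa using this
  refine h1.mono' (by fun_prop) (Filter.Eventually.of_forall fun x => ?_)
  rw [Real.norm_eq_abs, abs_mul, abs_abs, abs_of_pos (Real.exp_pos _)]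
  have : Real.exp (-l * x ^ 2) ≤ 1 := Real.exp_le_one_iff.2 (by nlinarith [sq_nonneg x])
  exact mul_le_of_le_one_right (abs_nonneg _) this

theorem integral_abs_mul_exp_neg_mul_sq_gaussianReal {l : ℝ} (hl : 0 ≤ l) :
    ∫ x, |x| * Real.exp (-l * x ^ 2) ∂gaussianReal 0 1
      = 2 * (√(2 * Real.pi))⁻¹ * (1 + 2 * l)⁻¹ := by
  rw [integral_gaussianReal_eq_integral_smul one_ne_zero]
  simp only [gaussianPDFReal_zero_one, smul_eq_mul]
  have : ∀ x : ℝ, (√(2 * Real.pi))⁻¹ * Real.exp (-(1 / 2) * x ^ 2)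
      * (|x| * Real.exp (-l * x ^ 2))
      = (√(2 * Real.pi))⁻¹ * (|x| * Real.exp (-(l + 1 / 2) * |x| ^ 2)) := by
    intro x
    rw [sq_abs, show -(l + 1 / 2) * x ^ 2 = -(1 / 2) * x ^ 2 + -l * x ^ 2 by ring, Real.exp_add]
    ring
  simp only [this]
  rw [integral_const_mul, integral_comp_abs (f := fun y => y * Real.exp (-(l + 1 / 2) * y ^ 2))]
  have h2 := integral_rpow_mul_exp_neg_mul_rpow (p := 2) (q := 1) (b := l + 1 / 2) two_pos
    (by norm_num) (by linarith)
  simp only [Real.rpow_one, Real.rpow_two] at h2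
  rw [h2]
  norm_num
  rw [Real.rpow_neg_one]
  have : 0 < l + 1 / 2 := by linarith
  have : 0 < 1 + 2 * l := by linarith
  field_simp
  ring

theorem exp_neg_mul_sum_sq {n : ℕ} (l : ℝ) (g : Fin n → ℝ) :
    Real.exp (-l * ∑ i, g i ^ 2) = ∏ i, Real.exp (-l * g i ^ 2) := by
  rw [← Real.exp_sum, Finset.mul_sum]

/-- Markov's inequality for a product of exponentials. Positive `l` gives the lower tail of the
squared norm, negative `l` the upper tail. -/
theorem gaussPi_chernoff (n : ℕ) {l : ℝ} (hl : -(1 / 2) < l) (c : ℝ) :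
    (gaussPi n).real {g | c ≤ -l * ∑ i, g i ^ 2} ≤ Real.exp (-c) * (√(1 + 2 * l))⁻¹ ^ n := by
  have hint : Integrable (fun g : Fin n → ℝ => ∏ i, Real.exp (-l * g i ^ 2)) (gaussPi n) :=
    Integrable.fintype_prod (f := fun _ x => Real.exp (-l * x ^ 2))
      fun _ => integrable_exp_neg_mul_sq_gaussianReal hl
  have h1 := mul_meas_ge_le_integral_of_nonneg (μ := gaussPi n)
    (f := fun g => ∏ i, Real.exp (-l * g i ^ 2))
    (Filter.Eventually.of_forall fun g => Finset.prod_nonneg fun i _ => (Real.exp_pos _).le)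
    hint (Real.exp c)
  rw [integral_fintype_prod_eq_pow (fun x => Real.exp (-l * x ^ 2)),
    integral_exp_neg_mul_sq_gaussianReal hl, Fintype.card_fin] at h1
  simp only [← exp_neg_mul_sum_sq, Real.exp_le_exp] at h1
  rw [Real.exp_neg, inv_mul_eq_div, le_div_iff₀ (Real.exp_pos _), mul_comm]
  exact h1

/-! ### Lower bound for the Gaussian mass of a conical sector. -/

/-- The tangent of the angle with sine `a`. -/
def tanArcsin (a : ℝ) : ℝ := a / √(1 - a ^ 2)

theorem one_sub_sq_pos {a : ℝ} (h : |a| < 1) : 0 < 1 - a ^ 2 := by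
  have := (sq_lt_one_iff_abs_lt_one a).2 h
  linarith

theorem tanArcsin_neg (a : ℝ) : tanArcsin (-a) = -tanArcsin a := by
  simp [tanArcsin, neg_div]

theorem abs_tanArcsin_le {a b : ℝ} (hab : |a| ≤ b) (hb : b < 1) : |tanArcsin a| ≤ tanArcsin b := by
  have hb0 : 0 ≤ b := (abs_nonneg a).trans hab
  have h1 : a ^ 2 ≤ b ^ 2 := by rw [← sq_abs a]; gcongr
  have h2 := one_sub_sq_pos (a := b) (by rwa [abs_of_nonneg hb0])
  unfold tanArcsin
  rw [abs_div, abs_of_nonneg (Real.sqrt_nonneg _)]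
  gcongr

theorem sub_le_tanArcsin_sub {a b : ℝ} (hab : a ≤ b) (ha : |a| < 1) (hb : |b| < 1) :
    b - a ≤ tanArcsin b - tanArcsin a := by
  have hpos : ∀ {x y : ℝ}, 0 ≤ x → x ≤ y → y < 1 → y - x ≤ tanArcsin y - tanArcsin x := by
    intro x y hx hxy hy
    have hy0 := hx.trans hxy
    have s1 := Real.sqrt_pos.2 (one_sub_sq_pos (a := y) (by rwa [abs_of_nonneg hy0]))
    have s2 : √(1 - y ^ 2) ≤ √(1 - x ^ 2) := by gcongr
    have s3 : √(1 - x ^ 2) ≤ 1 := Real.sqrt_le_one.2 (by nlinarith)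
    have i1 : 1 ≤ (√(1 - x ^ 2))⁻¹ := (one_le_inv₀ (s1.trans_le s2)).2 s3
    have i2 : (√(1 - x ^ 2))⁻¹ ≤ (√(1 - y ^ 2))⁻¹ := by gcongr
    unfold tanArcsin
    rw [div_eq_mul_inv, div_eq_mul_inv]
    nlinarith
  have h0 : ∀ {y : ℝ}, 0 ≤ y → y < 1 → y ≤ tanArcsin y := by
    intro y hy hy1
    simpa [tanArcsin] using hpos le_rfl hy hy1
  rw [abs_lt] at ha hb
  rcases le_total 0 a with h | h
  · exact hpos h hab hb.2
  · rcases le_total 0 b with h' | h'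
    · have := h0 h' hb.2
      have := h0 (neg_nonneg.2 h) (by linarith)
      rw [tanArcsin_neg] at this
      linarith
    · have := hpos (neg_nonneg.2 h') (neg_le_neg hab) (by linarith)
      rw [tanArcsin_neg, tanArcsin_neg] at this
      linarith

/-- Turns the sector condition into an interval for the first coordinate once the other coordinates,
of norm `r`, are fixed. -/
theorem le_tanArcsin_mul_iff {b x r : ℝ} (hb : |b| < 1) (hr : 0 ≤ r) :
    x ≤ tanArcsin b * r ↔ x ≤ b * √(x ^ 2 + r ^ 2) := by
  have hs := one_sub_sq_pos hb
  have hs' := Real.sqrt_pos.2 hs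
  have e1 : √(1 - b ^ 2) ^ 2 = 1 - b ^ 2 := Real.sq_sqrt hs.le
  set s := √(1 - b ^ 2)
  have hq0 := Real.sqrt_nonneg (x ^ 2 + r ^ 2)
  have e2 : √(x ^ 2 + r ^ 2) ^ 2 = x ^ 2 + r ^ 2 := Real.sq_sqrt (by positivity)
  set q := √(x ^ 2 + r ^ 2)
  have e3 : x ≤ tanArcsin b * r ↔ x * s ≤ b * r := by
    rw [tanArcsin, div_mul_eq_mul_div, le_div_iff₀ hs']
  rw [e3]
  have key : (b * q) ^ 2 - x ^ 2 = (b * r) ^ 2 - (x * s) ^ 2 := by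
    rw [mul_pow, mul_pow, mul_pow, e1, e2]; ring
  rcases le_total 0 b with h | h
  · rcases le_total x 0 with hx | hx
    · exact ⟨fun _ => hx.trans (mul_nonneg h hq0),
        fun _ => (mul_nonpos_of_nonpos_of_nonneg hx hs'.le).trans (mul_nonneg h hr)⟩
    · rw [← pow_le_pow_iff_left₀ (mul_nonneg hx hs'.le) (mul_nonneg h hr) two_ne_zero,
        ← pow_le_pow_iff_left₀ hx (mul_nonneg h hq0) two_ne_zero]
      constructor <;> intro <;> linarith
  · rcases le_total x 0 with hx | hx
    · rw [← neg_le_neg_iff, ← neg_le_neg_iff (b := x),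
        ← pow_le_pow_iff_left₀ (neg_nonneg.2 (mul_nonpos_of_nonpos_of_nonneg h hr))
          (neg_nonneg.2 (mul_nonpos_of_nonpos_of_nonneg hx hs'.le)) two_ne_zero,
        ← pow_le_pow_iff_left₀ (a := -(b * q)) (b := -x)
          (neg_nonneg.2 (mul_nonpos_of_nonpos_of_nonneg h hq0)) (neg_nonneg.2 hx) two_ne_zero,
        neg_sq, neg_sq, neg_sq, neg_sq]
      constructor <;> intro <;> linarith
    · have hb' : b * q ≤ 0 := mul_nonpos_of_nonpos_of_nonneg h hq0
      have hb'' : b * r ≤ 0 := mul_nonpos_of_nonpos_of_nonneg h hr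
      have hxs : 0 ≤ x * s := mul_nonneg hx hs'.le
      constructor <;> intro h1
      · have : x * s = 0 := by linarith
        have hx0 : x = 0 := by
          rcases mul_eq_zero.1 this with h | h
          · exact h
          · exact absurd h hs'.ne'
        have hb0 : b * r = 0 := by linarith
        rw [hx0, hb0] at key
        have : b * q = 0 := by
          have : (b * q) ^ 2 = 0 := by rw [← sub_zero ((b * q) ^ 2)]; simpa using key
          simpa using this
        rw [hx0, this]
      · have hx0 : x = 0 := by linarith
        have hb0 : b * q = 0 := by linarith
        rw [hx0, hb0] at key
        have : (b * r) ^ 2 = 0 := by nlinarith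
        have : b * r = 0 := by simpa using this
        rw [hx0, this, zero_mul]

theorem gaussianReal_Ioc_ge {p q c : ℝ} (hp : |p| ≤ c) (hq : |q| ≤ c) :
    ENNReal.ofReal ((√(2 * Real.pi))⁻¹ * (Real.exp (-(1 / 2) * c ^ 2) * (q - p)))
      ≤ gaussianReal 0 1 (Set.Ioc p q) := by
  rw [gaussianReal_apply 0 one_ne_zero]
  have h1 : ∫⁻ _ in Set.Ioc p q,
      ENNReal.ofReal ((√(2 * Real.pi))⁻¹ * Real.exp (-(1 / 2) * c ^ 2))
        ≤ ∫⁻ x in Set.Ioc p q, gaussianPDF 0 1 x := by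
    refine setLIntegral_mono (measurable_gaussianPDF _ _) fun x hx => ?_
    rw [gaussianPDF, gaussianPDFReal_zero_one]
    have : x ^ 2 ≤ c ^ 2 := by
      rw [← sq_abs x]
      gcongr
      rw [abs_le] at *
      exact ⟨by linarith [hx.1], hx.2.trans hq.2⟩
    gcongr ENNReal.ofReal (_ * Real.exp ?_)
    linarith
  refine le_trans (le_of_eq ?_) h1
  rw [setLIntegral_const, Real.volume_Ioc, ← ENNReal.ofReal_mul (by positivity), mul_assoc]

theorem sum_abs_le_sqrt_mul_enorm₂ {m : ℕ} (z : Fin m → ℝ) : ∑ i, |z i| ≤ √m * enorm₂ z := by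
  rw [enorm₂, ← Real.sqrt_mul (by positivity)]
  refine Real.le_sqrt_of_sq_le ?_
  have := sq_sum_le_card_mul_sum_sq (s := (Finset.univ : Finset (Fin m))) (f := fun i => |z i|)
  simpa using this

/-- The `ℓ₁` norm replaces the Euclidean norm because each summand then factors over coordinates,
and the integral is explicit. -/
theorem integral_sum_abs_mul_exp {m : ℕ} {l : ℝ} (hl : 0 ≤ l) :
    Integrable (fun z : Fin m → ℝ => (∑ i, |z i|) * Real.exp (-l * ∑ i, z i ^ 2)) (gaussPi m) ∧
    ∫ z, (∑ i, |z i|) * Real.exp (-l * ∑ i, z i ^ 2) ∂gaussPi m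
      = m * (2 * (√(2 * Real.pi))⁻¹ * (√(1 + 2 * l))⁻¹ ^ (m + 1)) := by
  have e1 : ∀ z : Fin m → ℝ, (∑ i, |z i|) * Real.exp (-l * ∑ i, z i ^ 2)
      = ∑ i, ∏ j, (if j = i then |z j| else 1) * Real.exp (-l * z j ^ 2) := by
    intro z
    rw [exp_neg_mul_sum_sq, Finset.sum_mul]
    refine Finset.sum_congr rfl fun i _ => ?_
    rw [Finset.prod_mul_distrib, Finset.prod_ite_eq' Finset.univ i fun j => |z j|]
    simp
  have hI : ∀ i j : Fin m, Integrable
      (fun x : ℝ => (if j = i then |x| else 1) * Real.exp (-l * x ^ 2)) (gaussianReal 0 1) := by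
    intro i j
    split_ifs
    · exact integrable_abs_mul_exp_neg_mul_sq_gaussianReal hl
    · simpa using integrable_exp_neg_mul_sq_gaussianReal (by linarith : -(1 / 2) < l)
  have hI2 : ∀ i : Fin m, Integrable (fun z : Fin m → ℝ =>
      ∏ j, (if j = i then |z j| else 1) * Real.exp (-l * z j ^ 2)) (gaussPi m) := fun i =>
    Integrable.fintype_prod (f := fun j x => (if j = i then |x| else 1) * Real.exp (-l * x ^ 2))
      fun j => hI i j
  simp only [e1]
  refine ⟨integrable_finsetSum _ fun i _ => hI2 i, ?_⟩
  rw [integral_finsetSum _ fun i _ => hI2 i]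
  have e2 : ∀ i : Fin m, ∫ z : Fin m → ℝ,
      ∏ j, (if j = i then |z j| else 1) * Real.exp (-l * z j ^ 2) ∂gaussPi m
      = 2 * (√(2 * Real.pi))⁻¹ * (√(1 + 2 * l))⁻¹ ^ (m + 1) := by
    intro i
    rw [integral_fintype_prod_eq_prod
      (f := fun j x => (if j = i then |x| else 1) * Real.exp (-l * x ^ 2))]
    have : ∀ j, ∫ x, (if j = i then |x| else 1) * Real.exp (-l * x ^ 2) ∂gaussianReal 0 1
        = (√(1 + 2 * l))⁻¹ * if j = i then 2 * (√(2 * Real.pi))⁻¹ * (√(1 + 2 * l))⁻¹ else 1 := by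
      intro j
      split_ifs
      · rw [integral_abs_mul_exp_neg_mul_sq_gaussianReal hl]
        have : (1 + 2 * l)⁻¹ = (√(1 + 2 * l))⁻¹ * (√(1 + 2 * l))⁻¹ := by
          rw [← mul_inv, Real.mul_self_sqrt (by linarith)]
        rw [this]
        ring
      · simpa using integral_exp_neg_mul_sq_gaussianReal (by linarith : -(1 / 2) < l)
    simp only [this]
    rw [Finset.prod_mul_distrib, Finset.prod_const, Finset.prod_ite_eq']
    simp only [Finset.card_univ, Fintype.card_fin, Finset.mem_univ, if_true]
    ring
  simp only [e2]
  simp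

/-- Slice along the first coordinate: each slice contains an interval of length at least `(b-a)|z|`,
on which the density is at least its value at `tanArcsin β * |z|`. Then bound `|z|` below by its
`ℓ₁` norm over `√m` and integrate. -/
theorem gaussPi_sector_ge {m : ℕ} (hm : 0 < m) {a b β : ℝ} (hab : a ≤ b) (ha : |a| ≤ β)
    (hb : |b| ≤ β) (hβ : β < 1) :
    (b - a) * √m / Real.pi * √(1 - β ^ 2) ^ (m + 1)
      ≤ (gaussPi (m + 1)).real {g | a * enorm₂ g < g 0 ∧ g 0 ≤ b * enorm₂ g} := by
  have hβ0 : 0 ≤ β := (abs_nonneg a).trans ha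
  have hβ2 := one_sub_sq_pos (a := β) (by rwa [abs_of_nonneg hβ0])
  set S : Set (Fin (m + 1) → ℝ) := {g | a * enorm₂ g < g 0 ∧ g 0 ≤ b * enorm₂ g} with hS
  have hSm : MeasurableSet S := by
    have := measurable_enorm₂ (n := m + 1)
    refine (measurableSet_lt (f := fun g => a * enorm₂ g) (g := fun g : Fin (m + 1) → ℝ => g 0)
      (by fun_prop) (by fun_prop)).inter
      (measurableSet_le (f := fun g : Fin (m + 1) → ℝ => g 0) (g := fun g => b * enorm₂ g)
      (by fun_prop) (by fun_prop))
  have hmp := (measurePreserving_piFinSuccAbove (fun _ : Fin (m + 1) => gaussianReal 0 1) 0).symm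
  set E := MeasurableEquiv.piFinSuccAbove (fun _ : Fin (m + 1) => ℝ) 0
  -- With this `l` the density bound is `exp(-l|z|²)` up to the Gaussian constant, and
  -- `(1+2l)^(-1/2) = √(1-β²)`.
  set l := tanArcsin β ^ 2 / 2 with hl
  have hl0 : 0 ≤ l := by positivity
  have h1l : (√(1 + 2 * l))⁻¹ = √(1 - β ^ 2) := by
    rw [← Real.sqrt_inv, hl, tanArcsin, div_pow, Real.sq_sqrt hβ2.le]
    congr 1
    field_simp
    ring
  have hslice : ∀ z : Fin m → ℝ, ENNReal.ofReal ((√(2 * Real.pi))⁻¹ * (b - a) / √m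
      * ((∑ i, |z i|) * Real.exp (-l * ∑ i, z i ^ 2)))
      ≤ gaussianReal 0 1 ((fun x => (x, z)) ⁻¹' (E.symm ⁻¹' S)) := by
    intro z
    have hz := enorm₂_nonneg z
    have hsub : Set.Ioc (tanArcsin a * enorm₂ z) (tanArcsin b * enorm₂ z)
        ⊆ (fun x => (x, z)) ⁻¹' (E.symm ⁻¹' S) := by
      intro x hx
      have hE : E.symm (x, z) = Fin.cons x z := by
        simp [E, MeasurableEquiv.piFinSuccAbove, Fin.insertNthEquiv]
      have hn : enorm₂ (Fin.cons x z : Fin (m + 1) → ℝ) = √(x ^ 2 + enorm₂ z ^ 2) := by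
        rw [enorm₂_sq, enorm₂, Fin.sum_univ_succ]
        simp
      simp only [Set.mem_preimage, hE, hS, Set.mem_ofPred_eq, hn, Fin.cons_zero]
      have i1 := le_tanArcsin_mul_iff (x := x) (ha.trans_lt hβ) hz
      have i2 := le_tanArcsin_mul_iff (x := x) (hb.trans_lt hβ) hz
      exact ⟨not_le.1 fun h => absurd (i1.2 h) (not_le.2 hx.1), i2.1 hx.2⟩
    refine le_trans ?_ (measure_mono hsub)
    refine le_trans ?_ (gaussianReal_Ioc_ge (c := tanArcsin β * enorm₂ z) ?_ ?_)
    · apply ENNReal.ofReal_le_ofReal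
      rw [mul_div_assoc, mul_assoc]
      have e1 : Real.exp (-(1 / 2) * (tanArcsin β * enorm₂ z) ^ 2)
          = Real.exp (-l * ∑ i, z i ^ 2) := by
        rw [mul_pow, enorm₂_sq, hl]
        ring_nf
      rw [e1, ← sub_mul]
      have i1 := sub_le_tanArcsin_sub hab (ha.trans_lt hβ) (hb.trans_lt hβ)
      have i2 := sum_abs_le_sqrt_mul_enorm₂ z
      have hm' : 0 < √(m : ℝ) := Real.sqrt_pos.2 (by exact_mod_cast hm)
      refine mul_le_mul_of_nonneg_left ?_ (by positivity)
      calc (b - a) / √m * ((∑ i, |z i|) * Real.exp (-l * ∑ i, z i ^ 2))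
          ≤ (b - a) / √m * ((√m * enorm₂ z) * Real.exp (-l * ∑ i, z i ^ 2)) := by
            have : 0 ≤ (b - a) / √m := div_nonneg (sub_nonneg.2 hab) hm'.le
            gcongr
        _ = Real.exp (-l * ∑ i, z i ^ 2) * ((b - a) * enorm₂ z) := by
            field_simp
        _ ≤ _ := by gcongr
    · rw [abs_mul, abs_of_nonneg hz]
      gcongr
      exact abs_tanArcsin_le ha hβ
    · rw [abs_mul, abs_of_nonneg hz]
      gcongr
      exact abs_tanArcsin_le hb hβ
  obtain ⟨hint, hval⟩ := integral_sum_abs_mul_exp (m := m) hl0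
  have hmain : ENNReal.ofReal ((b - a) * √m / Real.pi * √(1 - β ^ 2) ^ (m + 1))
      ≤ gaussPi (m + 1) S := by
    rw [← hmp.measure_preimage_equiv S, Measure.prod_apply_symm (E.symm.measurable hSm)]
    refine le_trans (le_of_eq ?_) (lintegral_mono hslice)
    rw [← ofReal_integral_eq_lintegral_ofReal (hint.const_mul _), integral_const_mul, hval, h1l]
    · congr 1
      have hm' : 0 < (m : ℝ) := by exact_mod_cast hm
      have hpi : (√(2 * Real.pi))⁻¹ * (√(2 * Real.pi))⁻¹ = (2 * Real.pi)⁻¹ := by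
        rw [← mul_inv, Real.mul_self_sqrt (by positivity)]
      calc _ = (b - a) * (√m * √m / √m) * (2 * (2 * Real.pi)⁻¹) * √(1 - β ^ 2) ^ (m + 1) := by
            rw [mul_self_div_self, mul_inv]; field_simp
        _ = _ := by
            rw [← hpi, Real.mul_self_sqrt hm'.le]
            ring
    · exact Filter.Eventually.of_forall fun z => by
        have : 0 ≤ b - a := sub_nonneg.2 hab
        positivity
  rw [Measure.real, ← ENNReal.ofReal_le_iff_le_toReal (measure_ne_top _ _)]
  exact hmain

/-! ### Rotation invariance. -/

theorem exists_linearIsometryEquiv_apply_eq {E : Type*} [NormedAddCommGroup E]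
    [InnerProductSpace ℝ E] [CompleteSpace E] {v w : E} (h : ‖v‖ = ‖w‖) :
    ∃ f : E ≃ₗᵢ[ℝ] E, f v = w :=
  ⟨_, Submodule.reflection_sub h⟩

/-- A reflection taking `θ` to `η` preserves the Gaussian measure and the norm. The joint law is
needed because the norm stands in the denominator later. -/
theorem gaussPi_map_inner_eq {n : ℕ} {θ η : Fin n → ℝ} (h : ∑ i, θ i ^ 2 = ∑ i, η i ^ 2) :
    (gaussPi n).map (fun g => (∑ i, g i * θ i, enorm₂ g))
      = (gaussPi n).map (fun g => (∑ i, g i * η i, enorm₂ g)) := by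
  have hn : ‖WithLp.toLp 2 θ‖ = ‖WithLp.toLp 2 η‖ := by
    simp [EuclideanSpace.norm_eq, h]
  obtain ⟨f, hf⟩ := exists_linearIsometryEquiv_apply_eq hn
  have e1 : ∀ ζ : Fin n → ℝ, (gaussPi n).map (fun g => (∑ i, g i * ζ i, enorm₂ g))
      = (stdGaussian (EuclideanSpace ℝ (Fin n))).map
        (fun x => (inner ℝ x (WithLp.toLp 2 ζ), ‖x‖)) := by
    intro ζ
    rw [← map_pi_eq_stdGaussian, Measure.map_map (by fun_prop) (by fun_prop)]
    congr 1
    ext g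
    · simp [PiLp.inner_apply, mul_comm]
    · simp [EuclideanSpace.norm_eq, enorm₂]
  rw [e1, e1]
  conv_rhs => rw [← stdGaussian_map f, Measure.map_map (by fun_prop) (by fun_prop), ← hf]
  congr 1
  ext x
  · simp
  · simp

/-! ### Rounding a Gaussian vector to the lattice. -/

/-- The integer `k` whose cell `((k - 1/2) / s, (k + 1/2) / s]` contains `x`. -/
def roundAt (s x : ℝ) : ℤ := ⌈s * x - 1 / 2⌉

/-- The signed distance from `x` to the centre of its cell. -/
def roundErr (s x : ℝ) : ℝ := roundAt s x / s - x

theorem measurable_roundAt (s : ℝ) : Measurable (roundAt s) := by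
  unfold roundAt
  fun_prop

theorem measurable_roundErr (s : ℝ) : Measurable (roundErr s) := by
  have h : Measurable fun x => (roundAt s x : ℝ) :=
    (measurable_from_top (f := fun k : ℤ => (k : ℝ))).comp (measurable_roundAt s)
  unfold roundErr
  fun_prop

theorem roundAt_eq_iff {s : ℝ} (hs : 0 < s) (x : ℝ) (k : ℤ) :
    roundAt s x = k ↔ x ∈ Set.Ioc (((k : ℝ) - 1 / 2) / s) (((k : ℝ) + 1 / 2) / s) := by
  rw [roundAt, Int.ceil_eq_iff, Set.mem_Ioc, div_lt_iff₀ hs, le_div_iff₀ hs, mul_comm x s]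
  constructor <;> rintro ⟨h1, h2⟩ <;> constructor <;> linarith

theorem roundErr_mem_Icc {s : ℝ} (hs : 0 < s) (x : ℝ) :
    roundErr s x ∈ Set.Icc (-(1 / (2 * s))) (1 / (2 * s)) := by
  have h := (roundAt_eq_iff hs x (roundAt s x)).1 rfl
  have e1 : ∀ k : ℝ, (k - 1 / 2) / s = k / s - 1 / (2 * s) := fun k => by field_simp
  have e2 : ∀ k : ℝ, (k + 1 / 2) / s = k / s + 1 / (2 * s) := fun k => by field_simp
  rw [e1, e2] at h
  unfold roundErr
  constructor <;> linarith [h.1, h.2]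

/-- The error is odd except at the countably many cell endpoints, and the Gaussian is symmetric. -/
theorem integral_roundErr {s : ℝ} (hs : 0 < s) : ∫ x, roundErr s x ∂gaussianReal 0 1 = 0 := by
  have := nullSingletonClass_gaussianReal (μ := 0) (one_ne_zero (α := NNReal))
  have hae : ∀ᵐ x ∂gaussianReal 0 1, roundErr s (-x) = -roundErr s x := by
    have hc : (Set.range fun k : ℤ => ((k : ℝ) + 1 / 2) / s).Countable := Set.countable_range _
    filter_upwards [measure_eq_zero_iff_ae_notMem.1 (hc.measure_zero (gaussianReal 0 1))] with x hx
    have h1 : roundAt s (-x) = -roundAt s x := by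
      rw [roundAt_eq_iff hs]
      have h := (roundAt_eq_iff hs x (roundAt s x)).1 rfl
      have hne : x ≠ ((roundAt s x : ℝ) + 1 / 2) / s := fun h' => hx ⟨_, h'.symm⟩
      have hlt := lt_of_le_of_ne h.2 hne
      push_cast
      constructor
      · rw [show (-(roundAt s x : ℝ) - 1 / 2) / s = -(((roundAt s x : ℝ) + 1 / 2) / s) by ring]
        exact neg_lt_neg hlt
      · rw [show (-(roundAt s x : ℝ) + 1 / 2) / s = -(((roundAt s x : ℝ) - 1 / 2) / s) by ring]
        exact (neg_lt_neg h.1).le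
    rw [roundErr, roundErr, h1]
    push_cast
    ring
  have hmap : ∫ x, roundErr s (-x) ∂gaussianReal 0 1 = ∫ x, roundErr s x ∂gaussianReal 0 1 := by
    have h := gaussianReal_map_neg (μ := 0) (v := 1)
    rw [neg_zero] at h
    conv_rhs => rw [← h]
    rw [integral_map (by fun_prop) (measurable_roundErr s).aestronglyMeasurable]
  rw [integral_congr_ae hae, integral_neg] at hmap
  linarith

/-- Hoeffding: the errors are independent, centred and lie in an interval of length `1/s`, so the
variance proxy is `∑ θ_i²/(4s²) = 1/(4s²)`, whatever `n` is. -/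
theorem gaussPi_sum_roundErr_ge_le {n : ℕ} {s t : ℝ} (hs : 0 < s) (ht : 0 ≤ t) {θ : Fin n → ℝ}
    (hθ : ∑ i, θ i ^ 2 = 1) :
    (gaussPi n).real {g | t ≤ ∑ i, θ i * roundErr s (g i)} ≤ Real.exp (-(2 * s ^ 2 * t ^ 2)) := by
  have hsub : ∀ i, HasSubgaussianMGF (fun g : Fin n → ℝ => θ i * roundErr s (g i))
      (‖θ i‖₊ ^ 2 * (‖1 / (2 * s) - -(1 / (2 * s))‖₊ / 2) ^ 2) (gaussPi n) := by
    intro i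
    have hm : Measurable fun g : Fin n → ℝ => roundErr s (g i) :=
      (measurable_roundErr s).comp (measurable_pi_apply i)
    have h := (hasSubgaussianMGF_of_mem_Icc_of_integral_eq_zero (μ := gaussPi n) hm.aemeasurable
      (Filter.Eventually.of_forall fun g => roundErr_mem_Icc hs _) ?_).const_mul (θ i)
    · have hc : ‖θ i‖₊ ^ 2 = NNReal.mk (θ i ^ 2) (sq_nonneg (θ i)) := NNReal.eq (by simp)
      rw [hc]
      exact h
    rw [integral_comp_eval (μ := fun _ : Fin n => gaussianReal 0 1) (f := roundErr s)
      (measurable_roundErr s).aestronglyMeasurable, integral_roundErr hs]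
  have hind : iIndepFun (fun (i : Fin n) (g : Fin n → ℝ) => θ i * roundErr s (g i)) (gaussPi n) :=
    iIndepFun_pi (X := fun i x => θ i * roundErr s x)
      fun i => ((measurable_roundErr s).const_mul (θ i)).aemeasurable
  refine (HasSubgaussianMGF.measure_sum_ge_le_of_iIndepFun hind
    (s := Finset.univ) (fun i _ => hsub i) ht).trans (le_of_eq ?_)
  congr 1
  push_cast
  simp only [Real.norm_eq_abs (θ _), sq_abs]
  rw [← Finset.sum_mul, hθ, Real.norm_of_nonneg (by rw [sub_neg_eq_add]; positivity)]
  field_simp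
  ring

/-- Coordinatewise rounding. -/
def roundVec {n : ℕ} (s : ℝ) (g : Fin n → ℝ) : Fin n → ℤ := fun i => roundAt s (g i)

theorem measurable_roundVec {n : ℕ} (s : ℝ) : Measurable (roundVec s : (Fin n → ℝ) → Fin n → ℤ) :=
  measurable_pi_lambda _ fun i => (measurable_roundAt s).comp (measurable_pi_apply i)

theorem gaussPi_roundVec_preimage_singleton {n : ℕ} {s : ℝ} (hs : 0 < s) (x : Fin n → ℤ) :
    (gaussPi n).real (roundVec s ⁻¹' {x})
      = ∏ i, (Phi (((x i : ℝ) + 1 / 2) / s) - Phi (((x i : ℝ) - 1 / 2) / s)) := by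
  have h1 : (roundVec s ⁻¹' {x} : Set (Fin n → ℝ))
      = Set.univ.pi fun i => Set.Ioc (((x i : ℝ) - 1 / 2) / s) (((x i : ℝ) + 1 / 2) / s) := by
    ext g
    simp only [Set.mem_preimage, Set.mem_singleton_iff, Set.mem_pi, Set.mem_univ, true_imp_iff,
      ← roundAt_eq_iff hs]
    exact funext_iff
  rw [h1, Measure.real, Measure.pi_pi, ENNReal.toReal_prod]
  refine Finset.prod_congr rfl fun i _ => ?_
  have : (cdf (gaussianReal 0 1)).measure = gaussianReal 0 1 := measure_cdf _
  rw [← this, StieltjesFunction.measure_Ioc, ENNReal.toReal_ofReal]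
  · rfl
  · refine sub_nonneg.2 (monotone_cdf _ ?_)
    gcongr
    linarith

theorem sum_gaussPi_roundVec {n : ℕ} (s : ℝ) (A : Finset (Fin n → ℤ)) :
    ∑ x ∈ A, (gaussPi n).real (roundVec s ⁻¹' {x}) = (gaussPi n).real (roundVec s ⁻¹' A) :=
  sum_measureReal_preimage_singleton A fun x _ => measurable_roundVec s (measurableSet_singleton x)

/-! ### Multiplicities, existence of the matrix, and row counts. -/

section Multiplicity

variable {n N : ℕ} {ε : ℝ}

theorem mult_eq (hs : 0 < sigma ε) (x : Fin n → ℤ) :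
    mult N ε x = ⌊(N : ℝ) * (gaussPi n).real (roundVec (sigma ε) ⁻¹' {x})⌋ := by
  rw [gaussPi_roundVec_preimage_singleton hs, mult]

theorem mult_nonneg (hs : 0 < sigma ε) (x : Fin n → ℤ) : 0 ≤ mult N ε x := by
  rw [mult_eq hs]
  positivity

theorem sum_mult_le (hs : 0 < sigma ε) (A : Finset (Fin n → ℤ)) :
    ((∑ x ∈ A, mult N ε x : ℤ) : ℝ) ≤ N * (gaussPi n).real (roundVec (sigma ε) ⁻¹' A) := by
  rw [← sum_gaussPi_roundVec, Finset.mul_sum, Int.cast_sum]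
  refine Finset.sum_le_sum fun x _ => ?_
  rw [mult_eq hs]
  exact Int.floor_le _

theorem totalMult_le (hs : 0 < sigma ε) : totalMult N n ε ≤ N := by
  have h1 := sum_mult_le (N := N) hs (points n ε)
  have h2 : (gaussPi n).real (roundVec (sigma ε) ⁻¹' points n ε) ≤ 1 := measureReal_le_one
  have : ((totalMult N n ε : ℤ) : ℝ) ≤ N :=
    h1.trans (mul_le_of_le_one_right (Nat.cast_nonneg _) h2)
  exact_mod_cast this

theorem sub_totalMult_le (hs : 0 < sigma ε) :
    (N : ℝ) - totalMult N n ε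
      ≤ N * (gaussPi n).real {g | roundVec (sigma ε) g ∉ points n ε} + (points n ε).card := by
  have hm : MeasurableSet (roundVec (sigma ε) ⁻¹' points n ε : Set (Fin n → ℝ)) :=
    measurable_roundVec _ (Finset.measurableSet _)
  have h1 : (gaussPi n).real {g | roundVec (sigma ε) g ∉ points n ε}
      = 1 - (gaussPi n).real (roundVec (sigma ε) ⁻¹' points n ε) := by
    rw [← probReal_compl_eq_one_sub hm]
    rfl
  have h2 : (N : ℝ) * (gaussPi n).real (roundVec (sigma ε) ⁻¹' points n ε) - (points n ε).card
      ≤ totalMult N n ε := by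
    rw [← sum_gaussPi_roundVec, Finset.mul_sum, totalMult, Int.cast_sum, Finset.cast_card,
      ← Finset.sum_sub_distrib]
    refine Finset.sum_le_sum fun x _ => ?_
    rw [mult_eq hs]
    exact (Int.sub_one_lt_floor _).le
  rw [h1]
  linarith

theorem mult'_nonneg (hs : 0 < sigma ε) (x : Fin n → ℤ) : 0 ≤ mult' N ε x := by
  have h1 := mult_nonneg (N := N) hs x
  have h2 := totalMult_le (N := N) (n := n) hs
  unfold mult'
  split_ifs
  · linarith
  · exact h1

theorem sum_mult'_le (hs : 0 < sigma ε) (A : Finset (Fin n → ℤ)) :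
    ∑ x ∈ A, mult' N ε x ≤ ∑ x ∈ A, mult N ε x + (N - totalMult N n ε) := by
  have h2 := totalMult_le (N := N) (n := n) hs
  have h3 : ∀ x : Fin n → ℤ, mult' N ε x
      = mult N ε x + if x = 0 then ((N : ℤ) - totalMult N n ε) else 0 := by
    intro x
    unfold mult'
    split_ifs <;> ring
  simp only [h3]
  rw [Finset.sum_add_distrib, Finset.sum_ite_eq' A 0]
  split_ifs <;> linarith

theorem zero_mem_points (hα : 0 ≤ alpha ε) : (0 : Fin n → ℤ) ∈ points n ε := by
  rw [points, mem_latticeBall]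
  simp only [enorm₂, Pi.zero_apply, Int.cast_zero, ne_eq, OfNat.ofNat_ne_zero, not_false_eq_true,
    zero_pow, Finset.sum_const_zero, Real.sqrt_zero]
  positivity

theorem sum_mult'_points (hα : 0 ≤ alpha ε) : ∑ x ∈ points n ε, mult' N ε x = N := by
  have h3 : ∀ x : Fin n → ℤ, mult' N ε x
      = mult N ε x + if x = 0 then ((N : ℤ) - totalMult N n ε) else 0 := by
    intro x
    unfold mult'
    split_ifs <;> ring
  simp only [h3]
  rw [Finset.sum_add_distrib, Finset.sum_ite_eq', if_pos (zero_mem_points hα), totalMult]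
  ring

/-- Enumerate the disjoint union of blocks of sizes `c x` by `Fin N` and project to the block label.
-/
theorem exists_fun_card_fiber_eq {ι : Type*} [DecidableEq ι] (s : Finset ι) (c : ι → ℕ)
    (h : ∑ x ∈ s, c x = N) :
    ∃ p : Fin N → ι, (∀ i, p i ∈ s) ∧ ∀ x ∈ s, (Finset.univ.filter fun i => p i = x).card = c x := by
  have hc : Fintype.card (Fin N) = Fintype.card (Σ x : s, Fin (c x)) := by
    rw [Fintype.card_sigma, Fintype.card_fin, ← h, ← Finset.sum_coe_sort]
    simp
  let f := Fintype.equivOfCardEq hc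
  refine ⟨fun i => (f i).1, fun i => (f i).1.2, fun x hx => ?_⟩
  have e1 : (Finset.univ.filter fun i => ((f i).1 : ι) = x).card
      = (Finset.univ.filter fun y : (Σ x : s, Fin (c x)) => y.1 = ⟨x, hx⟩).card := by
    refine Finset.card_equiv f fun i => ?_
    simp [Subtype.ext_iff]
  rw [e1, ← Fintype.card_subtype]
  exact (Fintype.card_congr (Equiv.sigmaSubtype (β := fun y : s => Fin (c y)) ⟨x, hx⟩)).trans
    (Fintype.card_fin _)

theorem exists_isEmbeddingMatrix (hs : 0 < sigma ε) (hα : 0 ≤ alpha ε) :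
    ∃ T : Matrix (Fin N) (Fin n) ℝ, IsEmbeddingMatrix ε T := by
  have h : ∑ x ∈ points n ε, (mult' N ε x).toNat = N := by
    zify
    rw [← sum_mult'_points (N := N) (n := n) hα]
    exact Finset.sum_congr rfl fun x _ => Int.toNat_of_nonneg (mult'_nonneg hs x)
  obtain ⟨p, hp, hc⟩ := exists_fun_card_fiber_eq _ _ h
  refine ⟨fun i => proj (p i), p, hp, fun x hx => ?_, fun _ _ => rfl⟩
  rw [hc x hx]
  exact Int.toNat_of_nonneg (mult'_nonneg hs x)

/-- Integer parts only lower the counts, so the only possible excess is the deficit `N - N'` put at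
the origin; it consists of the mass outside the ball and at most `1` per lattice point. -/
theorem card_filter_le (hs : 0 < sigma ε) {p : Fin N → Fin n → ℤ} (hp : ∀ i, p i ∈ points n ε)
    (hc : ∀ x ∈ points n ε, ((Finset.univ.filter fun i => p i = x).card : ℤ) = mult' N ε x)
    (A : Set (Fin n → ℤ)) [DecidablePred (· ∈ A)] :
    ((Finset.univ.filter fun i => p i ∈ A).card : ℝ)
      ≤ N * (gaussPi n).real {g | roundVec (sigma ε) g ∈ A}
        + N * (gaussPi n).real {g | roundVec (sigma ε) g ∉ points n ε} + (points n ε).card := by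
  have h1 : ((Finset.univ.filter fun i => p i ∈ A).card : ℤ)
      = ∑ x ∈ (points n ε).filter (· ∈ A), mult' N ε x := by
    rw [Finset.card_eq_sum_card_fiberwise (f := p) (t := (points n ε).filter (· ∈ A))
      fun i hi => by simpa using ⟨hp i, by simpa using hi⟩]
    push_cast
    refine Finset.sum_congr rfl fun x hx => ?_
    rw [Finset.mem_filter] at hx
    rw [← hc x hx.1, Finset.filter_filter]
    congr 2
    ext i
    simp only [Finset.mem_filter, Finset.mem_univ, true_and, and_iff_right_iff_imp]
    rintro rfl
    exact hx.2
  have h2 := sum_mult'_le (N := N) hs ((points n ε).filter (· ∈ A))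
  rw [← h1] at h2
  have h3 : (((Finset.univ.filter fun i => p i ∈ A).card : ℤ) : ℝ)
      ≤ ((∑ x ∈ (points n ε).filter (· ∈ A), mult N ε x + (N - totalMult N n ε) : ℤ) : ℝ) := by
    exact_mod_cast h2
  have h4 := sum_mult_le (N := N) hs ((points n ε).filter (· ∈ A))
  have h5 := sub_totalMult_le (N := N) (n := n) hs
  have h6 : (gaussPi n).real (roundVec (sigma ε) ⁻¹' ((points n ε).filter (· ∈ A) : Finset _))
      ≤ (gaussPi n).real {g | roundVec (sigma ε) g ∈ A} :=
    measureReal_mono fun g hg => (Finset.mem_filter.1 (Finset.mem_coe.1 hg)).2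
  have h7 : (N : ℝ) * (gaussPi n).real
      (roundVec (sigma ε) ⁻¹' ((points n ε).filter (· ∈ A) : Finset _))
      ≤ N * (gaussPi n).real {g | roundVec (sigma ε) g ∈ A} := by gcongr
  rw [Int.cast_add, Int.cast_sub, Int.cast_natCast, Int.cast_natCast] at h3
  linarith

end Multiplicity

/-! ### Counting lattice points, and tails of the Gaussian norm. -/

theorem sum_Icc_pow_natAbs_le {q : ℝ} (h0 : 0 ≤ q) (h1 : q < 1) (R : ℤ) :
    ∑ k ∈ Finset.Icc (-R) R, q ^ k.natAbs ≤ 1 + 2 * (q / (1 - q)) := by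
  have hg := hasSum_geometric_of_lt_one h0 h1
  have h2 : HasSum (fun k : ℤ => q ^ k.natAbs) ((1 - q)⁻¹ + q * (1 - q)⁻¹) := by
    refine HasSum.of_nat_of_neg_add_one (by simpa using hg) ?_
    have e : ∀ m : ℕ, q ^ (-((m : ℤ) + 1)).natAbs = q * q ^ m := by
      intro m
      rw [Int.natAbs_neg, ← pow_succ']
      congr 1
    simp only [e]
    exact hg.mul_left q
  refine (sum_le_hasSum _ (fun k _ => by positivity) h2).trans (le_of_eq ?_)
  have : 1 - q ≠ 0 := by linarith
  field_simp
  ring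

/-- By Cauchy–Schwarz the ball lies in `∑|x_i| ≤ an`, where the weight `e^n ∏ q^|x_i|` with `q =
e^(-1/a)` is at least `1`. The sum of the weights over a box factors into geometric series. -/
theorem card_latticeBall_le (n : ℕ) {a : ℝ} (ha : 0 < a) :
    ((latticeBall n (a * √n)).card : ℝ) ≤ (Real.exp 1 * (1 + 2 * a)) ^ n := by
  set q := Real.exp (-(1 / a)) with hq
  have hq0 : 0 < q := Real.exp_pos _
  have hq1 : q < 1 := Real.exp_lt_one_iff.2 (by simpa using ha)
  have hqa : q / (1 - q) ≤ a := by
    rw [div_le_iff₀ (by linarith)]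
    have h1 : 1 / a + 1 ≤ Real.exp (1 / a) := Real.add_one_le_exp _
    have h2 : q * Real.exp (1 / a) = 1 := by rw [hq, ← Real.exp_add]; simp
    have h3 : q * (1 / a + 1) ≤ 1 := (mul_le_mul_of_nonneg_left h1 hq0.le).trans h2.le
    have h4 : a * (q * (1 / a + 1)) ≤ a * 1 := by gcongr
    have h5 : a * (q * (1 / a + 1)) = q + a * q := by field_simp
    linarith
  set R : ℤ := ⌈a * √n⌉ with hR
  have hone : ∀ x ∈ latticeBall n (a * √n), (1 : ℝ) ≤ Real.exp 1 ^ n * ∏ i, q ^ (x i).natAbs := by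
    intro x hx
    rw [mem_latticeBall] at hx
    have h1 := sum_abs_le_sqrt_mul_enorm₂ fun i => (x i : ℝ)
    have h2 : ∑ i, |(x i : ℝ)| ≤ a * n := by
      refine h1.trans ((mul_le_mul_of_nonneg_left hx (Real.sqrt_nonneg _)).trans (le_of_eq ?_))
      rw [mul_left_comm, Real.mul_self_sqrt (Nat.cast_nonneg _)]
    have h3 : ∏ i, q ^ (x i).natAbs = Real.exp (-(∑ i, |(x i : ℝ)|) / a) := by
      rw [neg_div, Finset.sum_div, ← Finset.sum_neg_distrib, Real.exp_sum]
      refine Finset.prod_congr rfl fun i _ => ?_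
      rw [hq, ← Real.exp_nat_mul, Nat.cast_natAbs, Int.cast_abs]
      congr 1
      ring
    rw [h3, ← Real.exp_nat_mul, ← Real.exp_add, Real.one_le_exp_iff, neg_div]
    have : (∑ i, |(x i : ℝ)|) / a ≤ n := by rw [div_le_iff₀ ha]; linarith
    linarith
  calc ((latticeBall n (a * √n)).card : ℝ) = ∑ x ∈ latticeBall n (a * √n), (1 : ℝ) := by simp
    _ ≤ ∑ x ∈ latticeBall n (a * √n), Real.exp 1 ^ n * ∏ i, q ^ (x i).natAbs :=
        Finset.sum_le_sum hone
    _ ≤ ∑ x ∈ Fintype.piFinset fun _ : Fin n => Finset.Icc (-R) R,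
          Real.exp 1 ^ n * ∏ i, q ^ (x i).natAbs :=
        Finset.sum_le_sum_of_subset_of_nonneg (Finset.filter_subset _ _)
          fun _ _ _ => by positivity
    _ = Real.exp 1 ^ n * (∑ k ∈ Finset.Icc (-R) R, q ^ k.natAbs) ^ n := by
        rw [← Finset.mul_sum,
          Finset.sum_prod_piFinset (Finset.Icc (-R) R) fun _ k => q ^ k.natAbs]
        simp
    _ ≤ Real.exp 1 ^ n * (1 + 2 * a) ^ n := by
        have := sum_Icc_pow_natAbs_le hq0.le hq1 R
        gcongr
        linarith
    _ = _ := by rw [mul_pow]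

theorem enorm₂_eq_norm {n : ℕ} (x : Fin n → ℝ) : enorm₂ x = ‖WithLp.toLp 2 x‖ := by
  simp [EuclideanSpace.norm_eq, enorm₂]

theorem abs_enorm₂_sub_le {n : ℕ} (x y : Fin n → ℝ) :
    |enorm₂ x - enorm₂ y| ≤ enorm₂ (fun i => x i - y i) := by
  simp only [enorm₂_eq_norm]
  exact abs_norm_sub_norm_le _ _

theorem enorm₂_le_of_forall_abs_le {n : ℕ} {x : Fin n → ℝ} {c : ℝ} (hc : 0 ≤ c)
    (h : ∀ i, |x i| ≤ c) : enorm₂ x ≤ √n * c := by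
  refine Real.sqrt_le_iff.2 ⟨by positivity, ?_⟩
  rw [mul_pow, Real.sq_sqrt (Nat.cast_nonneg _)]
  calc ∑ i, x i ^ 2 ≤ ∑ _i : Fin n, c ^ 2 := Finset.sum_le_sum fun i _ => by
        rw [← sq_abs]
        have := h i
        gcongr
    _ = n * c ^ 2 := by simp

theorem enorm₂_div {n : ℕ} (x : Fin n → ℝ) {s : ℝ} (hs : 0 < s) :
    enorm₂ (fun i => x i / s) = enorm₂ x / s := by
  simp only [enorm₂, div_pow, ← Finset.sum_div]
  rw [Real.sqrt_div (Finset.sum_nonneg fun _ _ => sq_nonneg _), Real.sqrt_sq hs.le]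

theorem abs_enorm₂_roundVec_sub_le {n : ℕ} {s : ℝ} (hs : 0 < s) (g : Fin n → ℝ) :
    |enorm₂ (fun i => (roundVec s g i : ℝ)) / s - enorm₂ g| ≤ √n * (1 / (2 * s)) := by
  rw [← enorm₂_div _ hs]
  refine (abs_enorm₂_sub_le _ _).trans (enorm₂_le_of_forall_abs_le (by positivity) fun i => ?_)
  exact abs_le.2 (roundErr_mem_Icc hs (g i))

theorem gaussPi_sum_sq_le {n : ℕ} {d : ℝ} (hd : 0 < d) :
    (gaussPi n).real {g | ∑ i, g i ^ 2 ≤ d ^ 2 * n} ≤ (2 * d) ^ n := by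
  have h := gaussPi_chernoff n (l := 1 / (2 * d ^ 2))
    (by have : 0 < 1 / (2 * d ^ 2) := by positivity
        linarith) (-(n / 2))
  have hset : {g : Fin n → ℝ | -((n : ℝ) / 2) ≤ -(1 / (2 * d ^ 2)) * ∑ i, g i ^ 2}
      = {g | ∑ i, g i ^ 2 ≤ d ^ 2 * n} := by
    ext g
    simp only [Set.mem_ofPred_eq]
    rw [neg_mul, neg_le_neg_iff, one_div_mul_eq_div, div_le_div_iff₀ (by positivity) two_pos]
    constructor <;> intro <;> linarith
  rw [hset] at h
  refine h.trans ?_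
  have e1 : Real.exp (- -((n : ℝ) / 2)) = Real.exp (1 / 2) ^ n := by
    rw [← Real.exp_nat_mul]
    ring_nf
  rw [e1, ← mul_pow]
  have e2 : Real.exp (1 / 2) ≤ 2 := by
    have h1 : Real.exp (1 / 2) ^ 2 = Real.exp 1 := by
      rw [← Real.exp_nat_mul]
      norm_num
    have h2 := Real.exp_one_lt_d9
    nlinarith [Real.exp_pos (1 / 2)]
  have e3 : (√(1 + 2 * (1 / (2 * d ^ 2))))⁻¹ ≤ d := by
    refine inv_le_of_inv_le₀ hd (Real.le_sqrt_of_sq_le ?_)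
    have : 2 * (1 / (2 * d ^ 2)) = d⁻¹ ^ 2 := by field_simp
    linarith
  gcongr

theorem gaussPi_sum_sq_ge {n : ℕ} {d : ℝ} (hd : 0 < d) :
    (gaussPi n).real {g | (4 * Real.log d⁻¹ - 1) * n ≤ ∑ i, g i ^ 2} ≤ (2 * d) ^ n := by
  have h := gaussPi_chernoff n (l := -(1 / 4)) (by norm_num) ((Real.log d⁻¹ - 1 / 4) * n)
  have hset : {g : Fin n → ℝ | (Real.log d⁻¹ - 1 / 4) * n ≤ -(-(1 / 4)) * ∑ i, g i ^ 2}
      = {g | (4 * Real.log d⁻¹ - 1) * n ≤ ∑ i, g i ^ 2} := by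
    ext g
    simp only [Set.mem_ofPred_eq]
    constructor <;> intro <;> linarith
  rw [hset] at h
  refine h.trans ?_
  have e1 : Real.exp (-((Real.log d⁻¹ - 1 / 4) * n)) = (d * Real.exp (1 / 4)) ^ n := by
    have : d * Real.exp (1 / 4) = Real.exp (-(Real.log d⁻¹ - 1 / 4)) := by
      rw [Real.log_inv, neg_sub, sub_neg_eq_add, Real.exp_add, Real.exp_log hd, mul_comm]
    rw [this, ← Real.exp_nat_mul]
    ring_nf
  rw [e1, ← mul_pow]
  have e2 : Real.exp (1 / 4) ≤ √2 := by
    refine Real.le_sqrt_of_sq_le ?_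
    have h1 : (Real.exp (1 / 4) ^ 2) ^ 2 = Real.exp 1 := by
      rw [← pow_mul, ← Real.exp_nat_mul]
      norm_num
    have h2 := Real.exp_one_lt_d9
    nlinarith [sq_nonneg (Real.exp (1 / 4))]
  have e3 : (√(1 + 2 * -(1 / 4)))⁻¹ = √2 := by
    rw [← Real.sqrt_inv]
    norm_num
  rw [e3]
  have e4 : Real.exp (1 / 4) * √2 ≤ 2 := by
    calc _ ≤ √2 * √2 := by gcongr
      _ = 2 := Real.mul_self_sqrt two_pos.le
  rw [mul_assoc, mul_comm 2 d]
  gcongr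

/-! ### Error probabilities for the chosen parameters. -/

section Parameters

variable {ε : ℝ}

theorem delta_pos (hε : 0 < ε) : 0 < delta ε := by
  unfold delta
  positivity

theorem delta_le (hε : ε ≤ 1 / 2) : delta ε ≤ 1 / 2858 := by
  unfold delta
  linarith

theorem sigma_pos (hε : 0 < ε) : 0 < sigma ε := by
  have := delta_pos hε
  unfold sigma
  positivity

theorem log_inv_delta_le (hε : 0 < ε) : Real.log (delta ε)⁻¹ ≤ (delta ε)⁻¹ :=
  Real.log_le_self (inv_nonneg.2 (delta_pos hε).le)

theorem one_le_log_inv_delta (hε : 0 < ε) (hε2 : ε ≤ 1 / 2) : 1 ≤ Real.log (delta ε)⁻¹ := by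
  have hd := delta_pos hε
  rw [Real.le_log_iff_exp_le (inv_pos.2 hd)]
  have h2 := Real.exp_one_lt_d9
  have : (2858 : ℝ) ≤ (delta ε)⁻¹ := by
    rw [le_inv_comm₀ (by norm_num) hd]
    have := delta_le hε2
    norm_num at *
    exact this
  linarith

theorem alpha_pos (hε : 0 < ε) (hε2 : ε ≤ 1 / 2) : 0 < alpha ε := by
  have hd := delta_pos hε
  have := one_le_log_inv_delta hε hε2
  have : 0 < √(Real.log (delta ε)⁻¹) := Real.sqrt_pos.2 (by linarith)
  unfold alpha
  positivity

theorem card_points_le {n N : ℕ} (hε : 0 < ε) (hε2 : ε ≤ 1 / 2)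
    (hN : ε⁻¹ ^ (100 * n) ≤ N) : ((points n ε).card : ℝ) ≤ N * (2 * delta ε) ^ n := by
  have hd := delta_pos hε
  have h1 := card_latticeBall_le n (alpha_pos hε hε2)
  refine h1.trans (le_trans ?_ (mul_le_mul_of_nonneg_right hN (by positivity)))
  rw [pow_mul, ← mul_pow]
  have hα := alpha_pos hε hε2
  refine pow_le_pow_left₀ (by positivity) ?_ n
  have hx : 1 ≤ (delta ε)⁻¹ := (one_le_inv₀ hd).2 ((delta_le hε2).trans (by norm_num))
  have hs : √(Real.log (delta ε)⁻¹) ≤ (delta ε)⁻¹ := by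
    refine Real.sqrt_le_iff.2 ⟨by positivity, ?_⟩
    have := log_inv_delta_le hε
    nlinarith
  have hα2 : alpha ε ≤ 2 * (delta ε)⁻¹ ^ 5 := by
    unfold alpha
    calc _ ≤ 2 * (delta ε)⁻¹ ^ 4 * (delta ε)⁻¹ := by gcongr
      _ = _ := by ring
  have he := Real.exp_one_lt_d9
  have h5 : Real.exp 1 * (1 + 2 * alpha ε) ≤ 15 * (delta ε)⁻¹ ^ 5 := by
    have : 1 ≤ (delta ε)⁻¹ ^ 5 := one_le_pow₀ hx
    calc Real.exp 1 * (1 + 2 * alpha ε) ≤ 3 * (5 * (delta ε)⁻¹ ^ 5) := by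
          gcongr
          · linarith
          · linarith
      _ = _ := by ring
  refine h5.trans ?_
  have e1 : (delta ε)⁻¹ = 1429 * ε⁻¹ := by
    rw [delta, inv_div]
    ring
  have e2 : delta ε = ε / 1429 := rfl
  rw [e1, e2]
  have hy : (2 : ℝ) ≤ ε⁻¹ := by
    rw [le_inv_comm₀ two_pos hε]
    linarith
  -- Five powers of `1/ε` match `δ⁻⁵`; the other `94`, each at least `2`, swamp the numerical
  -- constants.
  have e3 : ε⁻¹ ^ 100 * (2 * (ε / 1429)) = 2 / 1429 * (ε⁻¹ ^ 94 * ε⁻¹ ^ 5) := by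
    linear_combination (2 / 1429 * ε⁻¹ ^ 99) * inv_mul_cancel₀ hε.ne'
  rw [e3]
  have h94 : (2 : ℝ) ^ 94 ≤ ε⁻¹ ^ 94 := by gcongr
  have : 0 ≤ ε⁻¹ ^ 5 := by positivity
  rw [mul_pow, ← mul_assoc, ← mul_assoc]
  refine mul_le_mul_of_nonneg_right ?_ this
  refine le_trans ?_ (mul_le_mul_of_nonneg_left h94 (by norm_num))
  norm_num

theorem gaussPi_roundVec_notMem_points_le {n : ℕ} (hε : 0 < ε) (hε2 : ε ≤ 1 / 2) :
    (gaussPi n).real {g | roundVec (sigma ε) g ∉ points n ε} ≤ (2 * delta ε) ^ n := by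
  have hd := delta_pos hε
  have hs := sigma_pos hε
  refine (measureReal_mono fun g hg => ?_).trans (gaussPi_sum_sq_ge hd)
  simp only [Set.mem_ofPred_eq, points, mem_latticeBall, not_le] at hg ⊢
  have hL := one_le_log_inv_delta hε hε2
  have hL' := log_inv_delta_le hε
  set L := Real.log (delta ε)⁻¹
  have hr := abs_le.1 (abs_enorm₂_roundVec_sub_le hs g)
  have e1 : 1 / (2 * sigma ε) = delta ε ^ 4 / 2 := by
    unfold sigma
    field_simp
  have e2 : alpha ε * √n / sigma ε = 2 * √L * √n := by
    have : alpha ε = 2 * sigma ε * √L := rfl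
    rw [this]
    field_simp
  have h1 : 2 * √L * √n < enorm₂ (fun i => (roundVec (sigma ε) g i : ℝ)) / sigma ε := by
    rw [← e2]
    gcongr
  rw [e1] at hr
  have h2 : (2 * √L - delta ε ^ 4 / 2) * √n ≤ enorm₂ g := by linarith [hr.2]
  have hsq : √L ^ 2 = L := Real.sq_sqrt (by linarith)
  have hsL : 1 ≤ √L := Real.one_le_sqrt.2 hL
  have hd1 : delta ε ≤ 1 := (delta_le hε2).trans (by norm_num)
  have hd4 : delta ε ^ 4 ≤ delta ε := by
    have : delta ε ^ 3 ≤ 1 := pow_le_one₀ hd.le hd1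
    nlinarith
  have hsLd : √L * delta ε ≤ 1 / 2 := by
    have h3 : L * delta ε ≤ 1 := by
      have := mul_le_mul_of_nonneg_right hL' hd.le
      rwa [inv_mul_cancel₀ hd.ne'] at this
    have h4 : (√L * delta ε) ^ 2 ≤ (1 / 2) ^ 2 := by
      rw [mul_pow, hsq]
      have := delta_le hε2
      nlinarith
    exact (pow_le_pow_iff_left₀ (by positivity) (by norm_num) two_ne_zero).1 h4
  rw [← enorm₂_sq]
  have h0 : 0 ≤ 2 * √L - delta ε ^ 4 / 2 := by linarith
  calc (4 * L - 1) * n ≤ (2 * √L - delta ε ^ 4 / 2) ^ 2 * n := by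
        gcongr
        have : √L * delta ε ^ 4 ≤ 1 / 2 := by nlinarith
        nlinarith [sq_nonneg (delta ε ^ 4)]
    _ = ((2 * √L - delta ε ^ 4 / 2) * √n) ^ 2 := by
        rw [mul_pow, Real.sq_sqrt (Nat.cast_nonneg _)]
    _ ≤ enorm₂ g ^ 2 := by gcongr

end Parameters

/-! ### Comparison of the tails of the rows with the spherical tail. -/

theorem measurableSet_mul_enorm₂_lt {n : ℕ} (a c : ℝ) (θ : Fin n → ℝ) :
    MeasurableSet {g : Fin n → ℝ | a * enorm₂ g < c * ∑ i, g i * θ i} := by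
  have := measurable_enorm₂ (n := n)
  exact measurableSet_lt (by fun_prop) (by fun_prop)

theorem gaussPi_sector_ge_of_unit {n : ℕ} (hn : 6 ≤ n) {θ : Fin n → ℝ} (hθ : ∑ i, θ i ^ 2 = 1)
    {a b β : ℝ} (hab : a ≤ b) (ha : |a| ≤ β * √n) (hb : |b| ≤ β * √n) (hβ : β < 1) :
    (b - a) / 4 * √(1 - β ^ 2) ^ n
      ≤ (gaussPi n).real {g | a * enorm₂ g < √n * ∑ i, g i * θ i ∧
          √n * ∑ i, g i * θ i ≤ b * enorm₂ g} := by
  obtain ⟨m, rfl⟩ : ∃ m, n = m + 1 := ⟨n - 1, by omega⟩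
  have hq : 0 < √((m + 1 : ℕ) : ℝ) := Real.sqrt_pos.2 (by positivity)
  set q := √((m + 1 : ℕ) : ℝ) with hqd
  have habs : ∀ {c : ℝ}, |c| ≤ β * q → |c / q| ≤ β := by
    intro c hc
    rwa [abs_div, abs_of_pos hq, div_le_iff₀ hq]
  have h := gaussPi_sector_ge (m := m) (by omega) (a := a / q) (b := b / q) (by gcongr)
    (habs ha) (habs hb) hβ
  have hset : {g : Fin (m + 1) → ℝ | a / q * enorm₂ g < g 0 ∧ g 0 ≤ b / q * enorm₂ g}
      = (fun g => (∑ i, g i * (Pi.single 0 1 : Fin (m + 1) → ℝ) i, enorm₂ g)) ⁻¹'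
        {z : ℝ × ℝ | a * z.2 < q * z.1 ∧ q * z.1 ≤ b * z.2} := by
    ext g
    simp only [Set.mem_ofPred_eq, Set.mem_preimage, Pi.single_apply, mul_ite, mul_one, mul_zero,
      Finset.sum_ite_eq', Finset.mem_univ, if_true]
    rw [div_mul_eq_mul_div, div_mul_eq_mul_div, div_lt_iff₀ hq, le_div_iff₀ hq, mul_comm (g 0)]
  have hz : MeasurableSet {z : ℝ × ℝ | a * z.2 < q * z.1 ∧ q * z.1 ≤ b * z.2} :=
    (measurableSet_lt (f := fun z : ℝ × ℝ => a * z.2) (g := fun z => q * z.1)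
      (by fun_prop) (by fun_prop)).inter
      (measurableSet_le (f := fun z : ℝ × ℝ => q * z.1) (g := fun z => b * z.2)
      (by fun_prop) (by fun_prop))
  have hmeas : ∀ ζ : Fin (m + 1) → ℝ,
      Measurable fun g : Fin (m + 1) → ℝ => (∑ i, g i * ζ i, enorm₂ g) := by
    intro ζ
    have := measurable_enorm₂ (n := m + 1)
    fun_prop
  have hlaw := gaussPi_map_inner_eq (n := m + 1) (θ := Pi.single 0 1) (η := θ)
    (by rw [hθ]; simp [Pi.single_apply])
  rw [hset, ← map_measureReal_apply (hmeas _) hz, hlaw, map_measureReal_apply (hmeas _) hz] at h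
  refine le_trans ?_ h
  refine mul_le_mul_of_nonneg_right ?_ (by positivity)
  have hm : 5 ≤ (m : ℝ) := by exact_mod_cast (by omega : 5 ≤ m)
  have hpi := Real.pi_lt_d2
  have key : q * Real.pi ≤ 4 * √m := by
    refine (pow_le_pow_iff_left₀ (by positivity) (by positivity) two_ne_zero).1 ?_
    rw [mul_pow, mul_pow, hqd, Real.sq_sqrt (by positivity), Real.sq_sqrt (by positivity)]
    push_cast
    have : Real.pi ^ 2 ≤ 10 := by nlinarith [Real.pi_pos]
    nlinarith
  rw [← sub_div, div_mul_eq_mul_div, div_div, div_le_div_iff₀ (by norm_num) (by positivity)]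
  have : 0 ≤ b - a := sub_nonneg.2 hab
  nlinarith

theorem exp_neg_le_one_sub_sq_pow {n : ℕ} {β κ : ℝ} (hκ : 0 < κ) (h : κ ≤ 1 - β ^ 2) :
    Real.exp (-(n * β ^ 2 / (2 * κ))) ≤ √(1 - β ^ 2) ^ n := by
  have h0 : 0 < 1 - β ^ 2 := hκ.trans_le h
  have h1 : Real.exp (-(β ^ 2 / κ)) ≤ 1 - β ^ 2 := by
    rw [Real.exp_neg, inv_le_comm₀ (Real.exp_pos _) h0]
    have h2 : (1 - β ^ 2)⁻¹ = β ^ 2 / (1 - β ^ 2) + 1 := by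
      field_simp
      ring
    rw [h2]
    refine le_trans ?_ (Real.add_one_le_exp _)
    gcongr
  have h3 : Real.exp (-(β ^ 2 / (2 * κ))) ≤ √(1 - β ^ 2) := by
    refine Real.le_sqrt_of_sq_le (le_trans (le_of_eq ?_) h1)
    rw [← Real.exp_nat_mul]
    congr 1
    field_simp
    push_cast
    ring
  calc Real.exp (-(n * β ^ 2 / (2 * κ))) = Real.exp (-(β ^ 2 / (2 * κ))) ^ n := by
        rw [← Real.exp_nat_mul]
        congr 1
        ring
    _ ≤ _ := by gcongr

/-- Each of the two kinds of error is at most `(d/4) w` with `w = (1-β²)^(n/2)`, and the sector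
supplies `(d/2)(1+|t|) w`. -/
theorem error_terms_le {n : ℕ} (hn : 6 ≤ n) {d t β : ℝ} (hd : 0 < d) (hd2 : d ≤ 1 / 2858)
    (hβ : β * √n = |t| + 2 * d * (1 + |t|)) (hβ1 : β ≤ 1 - 12 * d) :
    3 * (2 * d) ^ n + Real.exp (-(2 * ((d⁻¹ ^ 4) ^ 2 * (d ^ 2 * (1 + |t|)) ^ 2)))
      ≤ 2 * d * (1 + |t|) / 4 * √(1 - β ^ 2) ^ n := by
  have ht := abs_nonneg t
  have hq : 0 < √(n : ℝ) := Real.sqrt_pos.2 (by exact_mod_cast (by omega : 0 < n))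
  have hβ0 : 0 ≤ β := by
    have : 0 ≤ β * √n := by rw [hβ]; positivity
    exact nonneg_of_mul_nonneg_left this hq
  have hκ : 20 * d ≤ 1 - β ^ 2 := by nlinarith
  set w := √(1 - β ^ 2) ^ n with hw
  have hw0 : 0 ≤ w := by positivity
  have i1 : 3 * (2 * d) ^ n ≤ d / 4 * w := by
    -- The first factor, to the power `n`, is at most `w`; the second leaves `(d/5)^3`, which is
    -- where `6 ≤ n` is used.
    have h1 : 2 * d = √(20 * d) * √(d / 5) := by
      rw [← Real.sqrt_mul (by positivity)]
      rw [show 20 * d * (d / 5) = (2 * d) ^ 2 by ring, Real.sqrt_sq (by positivity)]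
    have h2 : √(d / 5) ^ n ≤ (d / 5) ^ 3 := by
      have h3 : √(d / 5) ≤ 1 := Real.sqrt_le_one.2 (by linarith)
      calc √(d / 5) ^ n ≤ √(d / 5) ^ 6 := pow_le_pow_of_le_one (Real.sqrt_nonneg _) h3 hn
        _ = (√(d / 5) ^ 2) ^ 3 := by rw [← pow_mul]
        _ = _ := by rw [Real.sq_sqrt (by positivity)]
    have h4 : √(20 * d) ^ n ≤ w := by rw [hw]; gcongr
    rw [h1, mul_pow]
    have h5 : 3 * (d / 5) ^ 3 ≤ d / 4 := by
      have : d ^ 2 ≤ 1 := pow_le_one₀ hd.le (by linarith)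
      nlinarith
    calc 3 * (√(20 * d) ^ n * √(d / 5) ^ n) ≤ 3 * (w * (d / 5) ^ 3) := by gcongr
      _ = (3 * (d / 5) ^ 3) * w := by ring
      _ ≤ _ := by gcongr
  have i2 : Real.exp (-(2 * ((d⁻¹ ^ 4) ^ 2 * (d ^ 2 * (1 + |t|)) ^ 2))) ≤ d / 4 * w := by
    have h1 := exp_neg_le_one_sub_sq_pow (n := n) (by positivity) hκ
    have h2 : n * β ^ 2 = (|t| + 2 * d * (1 + |t|)) ^ 2 := by
      rw [← hβ, mul_pow, Real.sq_sqrt (Nat.cast_nonneg _), mul_comm]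
    have h3 : (|t| + 2 * d * (1 + |t|)) ^ 2 ≤ 2 * (1 + |t|) ^ 2 := by
      have : |t| + 2 * d * (1 + |t|) ≤ 6 / 5 * (1 + |t|) := by nlinarith
      calc _ ≤ (6 / 5 * (1 + |t|)) ^ 2 := by gcongr
        _ ≤ _ := by nlinarith [sq_nonneg (1 + |t|)]
    -- The exponent is `2d⁻⁴(1+|t|)²`: one half pays for the factor `d/4`, the other for the lower
    -- bound `exp(-nβ²/(40d))` of `w`.
    have h4 : Real.exp (-d⁻¹) ≤ d / 4 := by
      rw [Real.exp_neg, inv_le_comm₀ (Real.exp_pos _) (by positivity)]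
      have h5 := Real.quadratic_le_exp_of_nonneg (x := d⁻¹) (by positivity)
      have h6 : (2858 : ℝ) ≤ d⁻¹ := by
        rw [le_inv_comm₀ (by norm_num) hd]
        linarith
      have h7 : (d / 4)⁻¹ = 4 * d⁻¹ := by rw [inv_div, div_eq_mul_inv]
      rw [h7]
      nlinarith
    refine le_trans ?_ (mul_le_mul h4 h1 (Real.exp_pos _).le (by positivity))
    rw [← Real.exp_add, Real.exp_le_exp, h2]
    have h8 : (d⁻¹ ^ 4) ^ 2 * (d ^ 2 * (1 + |t|)) ^ 2 = d⁻¹ ^ 4 * (1 + |t|) ^ 2 := by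
      field_simp
    rw [h8]
    have hx : 1 ≤ d⁻¹ := (one_le_inv₀ hd).2 (by linarith)
    have hx3 : 1 ≤ d⁻¹ ^ 3 := one_le_pow₀ hx
    have h9 : d⁻¹ ≤ d⁻¹ ^ 4 := by
      calc d⁻¹ = d⁻¹ * 1 := by ring
        _ ≤ d⁻¹ * d⁻¹ ^ 3 := by gcongr
        _ = _ := by ring
    have h10 : 1 ≤ (1 + |t|) ^ 2 := by nlinarith
    have h11 : (|t| + 2 * d * (1 + |t|)) ^ 2 / (2 * (20 * d)) ≤ d⁻¹ * (1 + |t|) ^ 2 := by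
      rw [div_le_iff₀ (by positivity)]
      have : d⁻¹ * (1 + |t|) ^ 2 * (2 * (20 * d)) = 40 * (1 + |t|) ^ 2 := by field_simp; norm_num
      rw [this]
      nlinarith
    have h12 : d⁻¹ * (1 + |t|) ^ 2 ≤ d⁻¹ ^ 4 * (1 + |t|) ^ 2 := by gcongr
    have h13 : d⁻¹ * 1 ≤ d⁻¹ * (1 + |t|) ^ 2 := by gcongr
    linarith
  have i3 : d * w ≤ d * (1 + |t|) * w := by
    have : 0 ≤ d * w := by positivity
    nlinarith
  nlinarith

/-- Away from the two bad events, lowering the level by `2d(1+|t|)` gains at least `2d²(1+|t|)√n`.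
Half of it covers the error in the inner product, half the error in the norm. -/
theorem lt_inner_of_lt_proj {n : ℕ} {d s t : ℝ} (hd : 0 < d) (hd2 : d ≤ 1 / 2858)
    (hs : s = d⁻¹ ^ 4) {θ g : Fin n → ℝ}
    (hg : d ^ 2 * n < ∑ i, g i ^ 2)
    (hr : ∑ i, θ i * roundErr s (g i) < d ^ 2 * (1 + |t|))
    (h : t + 4 * d * (1 + |t|) < ∑ j, proj (roundVec s g) j * θ j) :
    (t + 2 * d * (1 + |t|)) * enorm₂ g < √n * ∑ i, g i * θ i := by
  have hspos : 0 < s := by rw [hs]; positivity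
  have ht := abs_nonneg t
  have hq0 := Real.sqrt_nonneg (n : ℝ)
  have hR := abs_le.1 (abs_enorm₂_roundVec_sub_le hspos g)
  have e1 : 1 / (2 * s) = d ^ 4 / 2 := by
    rw [hs]
    field_simp
  rw [e1] at hR
  have hG : d * √n < enorm₂ g := by
    refine Real.lt_sqrt_of_sq_lt ?_
    rwa [mul_pow, Real.sq_sqrt (Nat.cast_nonneg _)]
  set D := enorm₂ (fun i => (roundVec s g i : ℝ)) / s with hD
  have hn : 0 < √(n : ℝ) := by
    refine Real.sqrt_pos.2 (Nat.cast_pos.2 (Nat.pos_of_ne_zero ?_))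
    rintro rfl
    simp at hg
  have hd3 : d ^ 3 ≤ 1 := pow_le_one₀ hd.le (by linarith)
  have hd4 : d ^ 4 ≤ d := by nlinarith
  have hD0 : 0 < D := by nlinarith [hR.1]
  have e2 : (∑ j, proj (roundVec s g) j * θ j) * D
      = √n * (∑ i, g i * θ i + ∑ i, θ i * roundErr s (g i)) := by
    have hE : enorm₂ (fun i => (roundVec s g i : ℝ)) ≠ 0 := by
      intro h0
      rw [hD, h0, zero_div] at hD0
      exact lt_irrefl _ hD0
    rw [← Finset.sum_add_distrib, Finset.mul_sum, Finset.sum_mul]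
    refine Finset.sum_congr rfl fun i _ => ?_
    unfold proj roundErr
    rw [hD]
    simp only [roundVec] at hE ⊢
    field_simp
    ring
  have h1 := mul_lt_mul_of_pos_right h hD0
  rw [e2, mul_add] at h1
  have h2 : √n * ∑ i, θ i * roundErr s (g i) < √n * (d ^ 2 * (1 + |t|)) := by gcongr
  set t' := t + 4 * d * (1 + |t|) with ht'
  have h3 : |t'| ≤ 2 * (1 + |t|) := by
    refine (abs_add_le _ _).trans ?_
    rw [abs_of_nonneg (a := 4 * d * (1 + |t|)) (by positivity)]
    nlinarith
  have h4 : t' * enorm₂ g - |t'| * (√n * (d ^ 4 / 2)) ≤ t' * D := by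
    have : |t' * (D - enorm₂ g)| ≤ |t'| * (√n * (d ^ 4 / 2)) := by
      rw [abs_mul]
      gcongr
      exact abs_le.2 hR
    have := (abs_le.1 this).1
    linarith
  have h5 : |t'| * (√n * (d ^ 4 / 2)) ≤ √n * (d ^ 2 * (1 + |t|)) := by
    calc |t'| * (√n * (d ^ 4 / 2)) ≤ 2 * (1 + |t|) * (√n * (d ^ 2 / 2)) := by
          gcongr ?_ * (_ * (?_ / 2))
          exact pow_le_pow_of_le_one hd.le (by linarith) (by norm_num)
      _ = _ := by ring
  have h6 : 2 * d * (1 + |t|) * (d * √n) ≤ 2 * d * (1 + |t|) * enorm₂ g := by gcongr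
  have e3 : t' * enorm₂ g = (t + 2 * d * (1 + |t|)) * enorm₂ g
      + 2 * d * (1 + |t|) * enorm₂ g := by rw [ht']; ring
  nlinarith

/-- The empirical upper tail of the functional `θ` on the rows of the matrix is dominated by the
tail of `√n ⟨G, θ⟩ / |G|` at a slightly smaller level. -/
theorem card_lt_sum_proj_le {n N : ℕ} {ε : ℝ} (hε : 0 < ε) (hε2 : ε ≤ 1 / 2) (hn : 6 ≤ n)
    (hN : ε⁻¹ ^ (100 * n) ≤ N) {θ : Fin n → ℝ} (hθ : ∑ i, θ i ^ 2 = 1)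
    {p : Fin N → Fin n → ℤ} (hp : ∀ i, p i ∈ points n ε)
    (hc : ∀ x ∈ points n ε, ((Finset.univ.filter fun i => p i = x).card : ℤ) = mult' N ε x)
    {t : ℝ} (ht : |t| ≤ (1 - 17 * delta ε) * √n) :
    ((Finset.univ.filter fun i =>
        t + 4 * delta ε * (1 + |t|) < ∑ j, proj (p i) j * θ j).card : ℝ)
      ≤ N * (gaussPi n).real {g | t * enorm₂ g < √n * ∑ i, g i * θ i} := by
  classical
  have hd := delta_pos hε
  have hd2 := delta_le hε2
  have hs := sigma_pos hε
  have htn := abs_nonneg t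
  set d := delta ε with hdd
  have h1 := card_filter_le (N := N) hs hp hc
    {x : Fin n → ℤ | t + 4 * d * (1 + |t|) < ∑ j, proj x j * θ j}
  simp only [Set.mem_ofPred_eq] at h1
  have h2 := card_points_le (n := n) (N := N) hε hε2 hN
  have h3 := gaussPi_roundVec_notMem_points_le (n := n) hε hε2
  have h4 := gaussPi_sum_sq_le (n := n) hd
  have h5 := gaussPi_sum_roundErr_ge_le (n := n) hs
    (t := d ^ 2 * (1 + |t|)) (by positivity) hθ
  have hq : 2 ≤ √(n : ℝ) := by
    refine Real.le_sqrt_of_sq_le ?_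
    have : (6 : ℝ) ≤ n := by exact_mod_cast hn
    linarith
  set β := (|t| + 2 * d * (1 + |t|)) / √n with hβ
  have hβq : β * √n = |t| + 2 * d * (1 + |t|) := div_mul_cancel₀ _ (by positivity)
  -- Since `2 ≤ √n`, raising the level from `(1-17d)√n` costs at most `3d√n`.
  have hβ1 : β ≤ 1 - 12 * d := by
    rw [hβ, div_le_iff₀ (by positivity)]
    nlinarith
  have h6 := gaussPi_sector_ge_of_unit hn hθ (a := t) (b := t + 2 * d * (1 + |t|)) (β := β)
    (by linarith [(by positivity : 0 ≤ 2 * d * (1 + |t|))])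
    (by rw [hβq]; linarith [(by positivity : 0 ≤ 2 * d * (1 + |t|))])
    (by
      rw [hβq]
      refine (abs_add_le _ _).trans ?_
      rw [abs_of_nonneg (a := 2 * d * (1 + |t|)) (by positivity)])
    (by linarith)
  rw [add_sub_cancel_left] at h6
  have h7 := error_terms_le hn hd hd2 hβq hβ1
  set b := t + 2 * d * (1 + |t|) with hb
  have htb : t ≤ b := by linarith [(by positivity : 0 ≤ 2 * d * (1 + |t|))]
  have h8 : (gaussPi n).real {g | t + 4 * d * (1 + |t|)
        < ∑ j, proj (roundVec (sigma ε) g) j * θ j}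
      ≤ (gaussPi n).real {g | ∑ i, g i ^ 2 ≤ d ^ 2 * n}
        + (gaussPi n).real {g | d ^ 2 * (1 + |t|) ≤ ∑ i, θ i * roundErr (sigma ε) (g i)}
        + (gaussPi n).real {g | b * enorm₂ g < √n * ∑ i, g i * θ i} := by
    refine le_trans (measureReal_mono fun g hg => ?_) ((measureReal_union_le _ _).trans
      (add_le_add_left (measureReal_union_le _ _) _))
    by_cases hg1 : ∑ i, g i ^ 2 ≤ d ^ 2 * n
    · exact Or.inl (Or.inl hg1)
    by_cases hg2 : d ^ 2 * (1 + |t|) ≤ ∑ i, θ i * roundErr (sigma ε) (g i)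
    · exact Or.inl (Or.inr hg2)
    exact Or.inr (lt_inner_of_lt_proj hd hd2 rfl (not_le.1 hg1) (not_le.1 hg2) hg)
  -- The tail at `b` and the sector between `t` and `b` are disjoint parts of the tail at `t`; the
  -- sector is the room for all errors.
  have h9 : (gaussPi n).real {g | b * enorm₂ g < √n * ∑ i, g i * θ i}
      + (gaussPi n).real {g | t * enorm₂ g < √n * ∑ i, g i * θ i ∧
          √n * ∑ i, g i * θ i ≤ b * enorm₂ g}
      ≤ (gaussPi n).real {g | t * enorm₂ g < √n * ∑ i, g i * θ i} := by
    rw [← measureReal_union' ?_ (measurableSet_mul_enorm₂_lt _ _ _)]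
    · refine measureReal_mono fun g hg => ?_
      rcases hg with hg | hg
      · exact (mul_le_mul_of_nonneg_right htb (enorm₂_nonneg g)).trans_lt hg
      · exact hg.1
    · rw [Set.disjoint_left]
      intro g hg hg'
      exact absurd hg'.2 (not_le.2 hg)
  have e1 : 2 * sigma ε ^ 2 * (d ^ 2 * (1 + |t|)) ^ 2
      = 2 * ((d⁻¹ ^ 4) ^ 2 * (d ^ 2 * (1 + |t|)) ^ 2) := by
    rw [sigma]
    ring
  rw [e1] at h5
  have h10 : (gaussPi n).real {g | t + 4 * d * (1 + |t|)
        < ∑ j, proj (roundVec (sigma ε) g) j * θ j}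
      + (gaussPi n).real {g | roundVec (sigma ε) g ∉ points n ε} + (2 * d) ^ n
      ≤ (gaussPi n).real {g | t * enorm₂ g < √n * ∑ i, g i * θ i} := by
    linarith
  have h11 := mul_le_mul_of_nonneg_left h10 (Nat.cast_nonneg (α := ℝ) N)
  linarith

/-! ### Generalised quantiles of a probability measure. -/

section Quantile

variable {ν : Measure ℝ} [IsProbabilityMeasure ν] {q : ℝ}

theorem measureReal_Iio_csInf_le
    (hbdd : BddBelow {t | q ≤ ν.real (Set.Iic t)}) :
    ν.real (Set.Iio (sInf {t | q ≤ ν.real (Set.Iic t)})) ≤ q := by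
  set v := sInf {t | q ≤ ν.real (Set.Iic t)} with hv
  have h1 : ∀ s < v, cdf ν s ≤ q := fun s hs => by
    rw [cdf_eq_real]
    exact (not_le.1 fun h => absurd (csInf_le hbdd h) (not_le.2 hs)).le
  have hq : 0 ≤ q := (cdf_nonneg ν (v - 1)).trans (h1 _ (by linarith))
  have h2 : Function.leftLim (cdf ν) v ≤ q :=
    le_of_tendsto ((monotone_cdf ν).tendsto_leftLim v)
      (Filter.eventually_of_mem self_mem_nhdsWithin fun s hs => h1 s hs)
  rw [Measure.real, ← measure_cdf ν, StieltjesFunction.measure_Iio _ (tendsto_cdf_atBot ν),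
    sub_zero]
  exact ENNReal.toReal_le_of_le_ofReal hq (ENNReal.ofReal_le_ofReal h2)

theorem measureReal_Ioi_csInf_le (hne : {t | q ≤ ν.real (Set.Iic t)}.Nonempty) :
    ν.real (Set.Ioi (sInf {t | q ≤ ν.real (Set.Iic t)})) ≤ 1 - q := by
  set v := sInf {t | q ≤ ν.real (Set.Iic t)} with hv
  have h1 : ∀ s, v < s → q ≤ cdf ν s := by
    intro s hs
    obtain ⟨r, hr, hrs⟩ := exists_lt_of_csInf_lt hne hs
    rw [cdf_eq_real]
    exact le_trans hr (measureReal_mono (Set.Iic_subset_Iic.2 hrs.le))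
  have h2 : q ≤ cdf ν v := by
    have hc := ((cdf ν).right_continuous v).mono Set.Ioi_subset_Ici_self
    exact ge_of_tendsto hc (Filter.eventually_of_mem self_mem_nhdsWithin fun s hs => h1 s hs)
  rw [← Set.compl_Iic, probReal_compl_eq_one_sub measurableSet_Iic, ← cdf_eq_real]
  linarith

end Quantile

/-! ### The marginal law on the sphere. -/

/-- The law of `√n ⟨G, θ⟩ / |G|` for a standard Gaussian vector `G`. -/
def sphLaw {n : ℕ} (θ : Fin n → ℝ) : Measure ℝ :=
  (gaussPi n).map fun g => √n * (∑ i, g i * θ i) / enorm₂ g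

theorem measurable_ratio {n : ℕ} (θ : Fin n → ℝ) :
    Measurable fun g : Fin n → ℝ => √n * (∑ i, g i * θ i) / enorm₂ g := by
  have := measurable_enorm₂ (n := n)
  fun_prop

instance {n : ℕ} (θ : Fin n → ℝ) : IsProbabilityMeasure (sphLaw θ) :=
  Measure.isProbabilityMeasure_map (measurable_ratio θ).aemeasurable

theorem ae_enorm₂_pos {n : ℕ} (hn : 0 < n) : ∀ᵐ g ∂gaussPi n, 0 < enorm₂ g := by
  have := nullSingletonClass_gaussianReal (μ := 0) (one_ne_zero (α := NNReal))
  have h0 : gaussPi n {g | g ⟨0, hn⟩ = 0} = 0 :=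
    Measure.pi_hyperplane (fun _ : Fin n => gaussianReal 0 1) ⟨0, hn⟩ 0
  filter_upwards [measure_eq_zero_iff_ae_notMem.1 h0] with g hg
  refine Real.sqrt_pos.2 (lt_of_lt_of_le (pow_pos (abs_pos.2 hg) 2) ?_)
  rw [sq_abs]
  exact Finset.single_le_sum (f := fun i => g i ^ 2) (fun i _ => sq_nonneg _) (Finset.mem_univ _)

theorem sphLaw_eq {n : ℕ} {θ η : Fin n → ℝ} (h : ∑ i, θ i ^ 2 = ∑ i, η i ^ 2) :
    sphLaw θ = sphLaw η := by
  have hm : Measurable fun z : ℝ × ℝ => √n * z.1 / z.2 := by fun_prop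
  have hmeas : ∀ ζ : Fin n → ℝ, Measurable fun g : Fin n → ℝ => (∑ i, g i * ζ i, enorm₂ g) := by
    intro ζ
    have := measurable_enorm₂ (n := n)
    fun_prop
  have h1 := congrArg (Measure.map fun z : ℝ × ℝ => √n * z.1 / z.2) (gaussPi_map_inner_eq h)
  rwa [Measure.map_map hm (hmeas _), Measure.map_map hm (hmeas _)] at h1

theorem PhiN_eq {n : ℕ} (hn : 0 < n) {θ : Fin n → ℝ} (hθ : ∑ i, θ i ^ 2 = 1) (t : ℝ) :
    PhiN n t = (sphLaw θ).real (Set.Iic t) := by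
  rw [sphLaw_eq (η := Pi.single ⟨0, hn⟩ 1) (by rw [hθ]; simp [Pi.single_apply]), sphLaw,
    map_measureReal_apply (measurable_ratio _) measurableSet_Iic, PhiN, dif_pos hn]
  congr 1
  ext g
  simp [Pi.single_apply]

theorem sphLaw_Ioi {n : ℕ} (hn : 0 < n) (θ : Fin n → ℝ) (t : ℝ) :
    (sphLaw θ).real (Set.Ioi t)
      = (gaussPi n).real {g | t * enorm₂ g < √n * ∑ i, g i * θ i} := by
  rw [sphLaw, map_measureReal_apply (measurable_ratio _) measurableSet_Ioi]
  refine measureReal_congr ?_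
  filter_upwards [ae_enorm₂_pos hn] with g hg
  exact propext (lt_div_iff₀ hg)

theorem sphLaw_Ioc_ge {n : ℕ} (hn : 6 ≤ n) {θ : Fin n → ℝ} (hθ : ∑ i, θ i ^ 2 = 1)
    {a b β : ℝ} (hab : a ≤ b) (ha : |a| ≤ β * √n) (hb : |b| ≤ β * √n) (hβ : β < 1) :
    (b - a) / 4 * √(1 - β ^ 2) ^ n ≤ (sphLaw θ).real (Set.Ioc a b) := by
  refine (gaussPi_sector_ge_of_unit hn hθ hab ha hb hβ).trans (le_of_eq ?_)
  rw [sphLaw, map_measureReal_apply (measurable_ratio _) measurableSet_Ioc]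
  refine measureReal_congr ?_
  filter_upwards [ae_enorm₂_pos (by omega : 0 < n)] with g hg
  exact propext (and_congr (lt_div_iff₀ hg).symm (div_le_iff₀ hg).symm)

theorem sphLaw_Ioi_neg {n : ℕ} (θ : Fin n → ℝ) (t : ℝ) :
    (sphLaw θ).real (Set.Ioi (-t)) = (sphLaw θ).real (Set.Iio t) := by
  rw [sphLaw_eq (θ := θ) (η := fun i => -θ i) (by simp)]
  conv_rhs => rw [sphLaw_eq (θ := fun i => -θ i) (η := θ) (by simp)]
  rw [sphLaw, sphLaw, map_measureReal_apply (measurable_ratio _) measurableSet_Ioi,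
    map_measureReal_apply (measurable_ratio _) measurableSet_Iio]
  congr 1
  ext g
  simp [neg_div]

theorem abs_sum_proj_mul_le {n : ℕ} (x : Fin n → ℤ) {θ : Fin n → ℝ} (hθ : ∑ i, θ i ^ 2 = 1) :
    |∑ j, proj x j * θ j| ≤ √n := by
  refine abs_le_of_sq_le_sq ?_ (Real.sqrt_nonneg _)
  refine (Finset.sum_mul_sq_le_sq_mul_sq _ _ _).trans ?_
  rw [hθ, mul_one]
  simp only [proj, div_pow, mul_pow]
  rw [← Finset.sum_div, ← Finset.mul_sum, ← enorm₂_sq (fun i => (x i : ℝ)), mul_div_assoc]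
  exact mul_le_of_le_one_right (sq_nonneg _) (div_self_le_one _)

/-! ### Sorted vectors and counts. -/

section Sorted

variable {N : ℕ} {z : Fin N → ℝ}

theorem le_of_card_gt_lt (hz : Monotone z) {i : Fin N} {c : ℝ}
    (h : ((Finset.univ.filter fun j => c < z j).card : ℝ) < N - i) : z i ≤ c := by
  by_contra! hc
  have h1 : Finset.Ici i ⊆ Finset.univ.filter fun j => c < z j := fun j hj => by
    simpa using hc.trans_le (hz (Finset.mem_Ici.1 hj))
  have h2 := Finset.card_le_card h1
  rw [Fin.card_Ici] at h2
  have h3 : ((N - i : ℕ) : ℝ) ≤ ((Finset.univ.filter fun j => c < z j).card : ℝ) := by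
    exact_mod_cast h2
  rw [Nat.cast_sub i.2.le] at h3
  linarith

theorem le_of_card_lt_lt (hz : Monotone z) {i : Fin N} {c : ℝ}
    (h : ((Finset.univ.filter fun j => z j < c).card : ℝ) < i + 1) : c ≤ z i := by
  by_contra! hc
  have h1 : Finset.Iic i ⊆ Finset.univ.filter fun j => z j < c := fun j hj => by
    simpa using (hz (Finset.mem_Iic.1 hj)).trans_lt hc
  have h2 := Finset.card_le_card h1
  rw [Fin.card_Iic] at h2
  have h3 : ((i + 1 : ℕ) : ℝ) ≤ ((Finset.univ.filter fun j => z j < c).card : ℝ) := by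
    exact_mod_cast h2
  push_cast at h3
  linarith

theorem card_filter_comp_perm (y : Fin N → ℝ) (τ : Equiv.Perm (Fin N)) (P : ℝ → Prop)
    [DecidablePred P] :
    (Finset.univ.filter fun j => P (y (τ j))).card = (Finset.univ.filter fun j => P (y j)).card :=
  Finset.card_equiv τ fun i => by simp

theorem card_filter_add_half_le {c : ℝ} (hc : 0 ≤ c) :
    ((Finset.univ.filter fun i : Fin N => (i : ℝ) + 1 / 2 ≤ c).card : ℝ) ≤ c + 1 / 2 := by
  have h1 : (Finset.univ.filter fun i : Fin N => (i : ℝ) + 1 / 2 ≤ c).card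
      ≤ (Finset.range ⌊c + 1 / 2⌋₊).card := by
    refine Finset.card_le_card_of_injOn (fun i => i.val) (fun i hi => ?_)
      (fun i _ j _ h => Fin.ext h)
    rw [Finset.coe_filter] at hi
    have : (i : ℝ) + 1 / 2 ≤ c := hi.2
    simp only [Finset.coe_range, Set.mem_Iio]
    refine Nat.lt_of_succ_le (Nat.le_floor ?_)
    push_cast
    linarith
  rw [Finset.card_range] at h1
  exact (Nat.cast_le.2 h1).trans (Nat.floor_le (by linarith))

end Sorted

/-! ### Quantiles of the spherical law. -/

theorem two_le_sqrt_of_six_le {n : ℕ} (hn : 6 ≤ n) : 2 ≤ √(n : ℝ) := by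
  refine Real.le_sqrt_of_sq_le ?_
  have : (6 : ℝ) ≤ n := by exact_mod_cast hn
  linarith

theorem sphLaw_Iic_add_Ioc_le {n : ℕ} (θ : Fin n → ℝ) {a b : ℝ} (hab : a ≤ b) :
    (sphLaw θ).real (Set.Iic a) + (sphLaw θ).real (Set.Ioc a b) = (sphLaw θ).real (Set.Iic b) := by
  have hdisj : Disjoint (Set.Iic a) (Set.Ioc a b) :=
    Set.disjoint_left.2 fun x hx hx' => absurd hx'.1 (not_lt.2 hx)
  rw [← measureReal_union hdisj measurableSet_Ioc, Set.Iic_union_Ioc_eq_Iic hab]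

theorem sphLaw_Iic_lt {n : ℕ} (hn : 6 ≤ n) {θ : Fin n → ℝ} (hθ : ∑ i, θ i ^ 2 = 1) {B s : ℝ}
    (hB : 0 ≤ B) (hBn : B < √n) (hs : s < -B) :
    (sphLaw θ).real (Set.Iic s) < 1 - (sphLaw θ).real (Set.Iic B) := by
  have hq := two_le_sqrt_of_six_le hn
  -- A point strictly above `B` and below both `-s` and `√n`: the interval `(B, r]` has positive
  -- mass, which makes the inequality strict.
  set r := min ((B - s) / 2) ((B + √n) / 2) with hr
  have h1 : B < r := lt_min (by linarith) (by linarith)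
  have h2 : r < -s := (min_le_left _ _).trans_lt (by linarith)
  have h3 : r ≤ (B + √n) / 2 := min_le_right _ _
  have h5 : r / √n * √n = r := div_mul_cancel₀ _ (by positivity)
  have h4 : r / √n < 1 := by
    rw [div_lt_one (by positivity)]
    linarith
  have h6 := sphLaw_Ioc_ge hn hθ (a := B) (b := r) (β := r / √n) h1.le
    (by rw [h5, abs_of_nonneg hB]; exact h1.le) (by rw [h5, abs_of_nonneg (hB.trans h1.le)]) h4
  have h7 : 0 < (r - B) / 4 * √(1 - (r / √n) ^ 2) ^ n := by
    have : 0 ≤ r / √n := div_nonneg (hB.trans h1.le) (Real.sqrt_nonneg _)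
    have := Real.sqrt_pos.2 (one_sub_sq_pos (a := r / √n) (by rwa [abs_of_nonneg this]))
    have : 0 < r - B := by linarith
    positivity
  have h8 := sphLaw_Iic_add_Ioc_le θ h1.le
  have h9 : (sphLaw θ).real (Set.Iic r) ≤ (sphLaw θ).real (Set.Iio (-s)) :=
    measureReal_mono fun x hx => lt_of_le_of_lt hx h2
  rw [← sphLaw_Ioi_neg, neg_neg, ← Set.compl_Iic, probReal_compl_eq_one_sub measurableSet_Iic]
    at h9
  linarith

theorem PhiNInv_spec {n : ℕ} (hn : 6 ≤ n) {θ : Fin n → ℝ} (hθ : ∑ i, θ i ^ 2 = 1) {B q : ℝ}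
    (hB : 0 ≤ B) (hBn : B < √n) (h1 : 1 - PhiN n B ≤ q) (h2 : q ≤ PhiN n B) :
    |PhiNInv n q| ≤ B ∧ (sphLaw θ).real (Set.Ioi (PhiNInv n q)) ≤ 1 - q ∧
      (sphLaw θ).real (Set.Iio (PhiNInv n q)) ≤ q := by
  have hn0 : 0 < n := by omega
  rw [PhiN_eq hn0 hθ] at h1 h2
  have hS : {t | q ≤ PhiN n t} = {t | q ≤ (sphLaw θ).real (Set.Iic t)} := by
    simp only [PhiN_eq hn0 hθ]
  have hlow : ∀ s ∈ {t | q ≤ (sphLaw θ).real (Set.Iic t)}, -B ≤ s := by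
    intro s hs
    by_contra! h
    have := sphLaw_Iic_lt hn hθ hB hBn h
    have hs' : q ≤ (sphLaw θ).real (Set.Iic s) := hs
    linarith
  have hbdd : BddBelow {t | q ≤ (sphLaw θ).real (Set.Iic t)} := ⟨-B, hlow⟩
  have hne : {t | q ≤ (sphLaw θ).real (Set.Iic t)}.Nonempty := ⟨B, h2⟩
  rw [PhiNInv, hS]
  exact ⟨abs_le.2 ⟨le_csInf hne hlow, csInf_le hbdd h2⟩, measureReal_Ioi_csInf_le hne,
    measureReal_Iio_csInf_le hbdd⟩

theorem exists_sum_sq_eq_one {n : ℕ} (hn : 0 < n) : ∃ θ : Fin n → ℝ, ∑ i, θ i ^ 2 = 1 :=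
  ⟨Pi.single ⟨0, hn⟩ 1, by simp [Pi.single_apply]⟩

/-- The sector bound with `β = 1/√n` gives at least `e^(-3/5)/8`, uniformly in `n`. -/
theorem sphLaw_Ioc_half_ge {n : ℕ} (hn : 6 ≤ n) {θ : Fin n → ℝ} (hθ : ∑ i, θ i ^ 2 = 1) {a : ℝ}
    (ha : |a| ≤ 1) (ha' : |a + 1 / 2| ≤ 1) :
    67 / 1000 ≤ (sphLaw θ).real (Set.Ioc a (a + 1 / 2)) := by
  have hq := two_le_sqrt_of_six_le hn
  have h5 : 1 / √n * √n = 1 := div_mul_cancel₀ _ (by positivity)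
  have h := sphLaw_Ioc_ge hn hθ (a := a) (b := a + 1 / 2) (β := 1 / √n) (by linarith)
    (by rwa [h5]) (by rwa [h5]) (by rw [div_lt_one (by positivity)]; linarith)
  refine le_trans ?_ h
  have hn' : (6 : ℝ) ≤ n := by exact_mod_cast hn
  have e1 : (1 / √(n : ℝ)) ^ 2 = 1 / n := by
    rw [div_pow, Real.sq_sqrt (Nat.cast_nonneg _), one_pow]
  have h1 := exp_neg_le_one_sub_sq_pow (n := n) (β := 1 / √n) (κ := 5 / 6) (by norm_num) (by
    rw [e1]
    have : 1 / (n : ℝ) ≤ 1 / 6 := by gcongr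
    linarith)
  have e2 : (n : ℝ) * (1 / √n) ^ 2 / (2 * (5 / 6)) = 3 / 5 := by
    rw [e1]
    field_simp
    norm_num
  rw [e2] at h1
  have h2 : 27 / 50 ≤ Real.exp (-(3 / 5)) := by
    rw [Real.exp_neg, le_inv_comm₀ (by norm_num) (Real.exp_pos _)]
    refine (pow_le_pow_iff_left₀ (Real.exp_pos _).le (by norm_num)
      (by norm_num : (5 : ℕ) ≠ 0)).1 ?_
    have e3 : Real.exp (3 / 5) ^ 5 = Real.exp 1 ^ 3 := by
      rw [← Real.exp_nat_mul, ← Real.exp_nat_mul]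
      norm_num
    rw [e3]
    have h3 : Real.exp 1 ≤ 2.72 := Real.exp_one_lt_d9.le.trans (by norm_num)
    calc Real.exp 1 ^ 3 ≤ 2.72 ^ 3 := by gcongr
      _ ≤ _ := by norm_num
  rw [add_sub_cancel_left]
  linarith

/-! ### The truncated quantile vector and its distance to the sorted rows. -/

section

variable {n N : ℕ} {ε : ℝ}

/-- The truncation level `(1 - 17 δ) √n` of the quantiles. -/
def level (n : ℕ) (ε : ℝ) : ℝ := (1 - 17 * delta ε) * √(n : ℝ)

theorem one_le_level (hε2 : ε ≤ 1 / 2) (hn : 6 ≤ n) : 1 ≤ level n ε := by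
  have := delta_le hε2
  have := two_le_sqrt_of_six_le hn
  unfold level
  nlinarith

theorem level_lt (hε : 0 < ε) (hn : 6 ≤ n) : level n ε < √n := by
  have := delta_pos hε
  have := two_le_sqrt_of_six_le hn
  unfold level
  nlinarith

theorem bParam_eq (n : ℕ) (ε : ℝ) : bParam n ε = PhiN n (level n ε) := rfl

theorem bParam_ge (hε2 : ε ≤ 1 / 2) (hn : 6 ≤ n) : 67 / 1000 ≤ bParam n ε := by
  obtain ⟨θ, hθ⟩ := exists_sum_sq_eq_one (by omega : 0 < n)
  have h1 := one_le_level hε2 hn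
  rw [bParam_eq, PhiN_eq (by omega) hθ]
  refine (sphLaw_Ioc_half_ge hn hθ (a := -1) (by norm_num) (by
    rw [abs_le]; constructor <;> norm_num)).trans (measureReal_mono fun x hx => ?_)
  exact hx.2.trans (by linarith)

theorem half_le_vVec (hε2 : ε ≤ 1 / 2) (hn : 6 ≤ n) {i : Fin N}
    (hi : 933 / 1000 * N < (i : ℝ) + 1 / 2) : 1 / 2 ≤ vVec N n ε i := by
  have hN : (0 : ℝ) < N := by exact_mod_cast i.pos
  have hb := bParam_ge hε2 hn
  have hq := two_le_sqrt_of_six_le hn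
  unfold vVec
  rw [if_neg (by nlinarith)]
  split_ifs with h
  · obtain ⟨θ, hθ⟩ := exists_sum_sq_eq_one (by omega : 0 < n)
    rw [PhiNInv]
    refine le_csInf ⟨level n ε, ?_⟩ fun s hs => ?_
    · change _ ≤ PhiN n (level n ε)
      rw [div_le_iff₀ hN]
      exact h
    · by_contra! hs'
      have hs1 : ((i : ℝ) + 1 / 2) / N ≤ PhiN n s := hs
      rw [PhiN_eq (by omega) hθ, div_le_iff₀ hN] at hs1
      have h1 : (sphLaw θ).real (Set.Iic s) ≤ (sphLaw θ).real (Set.Iic (1 / 2)) :=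
        measureReal_mono (Set.Iic_subset_Iic.2 hs'.le)
      have h2 := sphLaw_Iic_add_Ioc_le θ (by norm_num : (1 / 2 : ℝ) ≤ 1 / 2 + 1 / 2)
      have h3 : (sphLaw θ).real (Set.Iic (1 / 2 + 1 / 2)) ≤ 1 := measureReal_le_one
      have h4 := sphLaw_Ioc_half_ge hn hθ (a := 1 / 2)
        (by rw [abs_le]; constructor <;> norm_num) (by norm_num)
      nlinarith
  · linarith

/-- The top `6.7%` of the entries are at least `1/2`, giving `0.0335 N - 1/4`, the last term being a
rounding loss in the count; this exceeds `N/33` for such `N`. -/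
theorem sum_max_vVec_ge (hε2 : ε ≤ 1 / 2) (hn : 6 ≤ n) (hN : 256 ≤ N) :
    1 / 33 * (N : ℝ) ≤ ∑ i, max (vVec N n ε i) 0 := by
  have hN' : (256 : ℝ) ≤ N := by exact_mod_cast hN
  have h1 : ∀ i : Fin N, 1 / 2 - (if (i : ℝ) + 1 / 2 ≤ 933 / 1000 * N then 1 / 2 else 0)
      ≤ max (vVec N n ε i) 0 := by
    intro i
    split_ifs with h
    · simp
    · rw [sub_zero]
      exact (half_le_vVec hε2 hn (not_le.1 h)).trans (le_max_left _ _)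
  refine le_trans ?_ (Finset.sum_le_sum fun i _ => h1 i)
  have h2 := card_filter_add_half_le (N := N) (c := 933 / 1000 * N) (by positivity)
  rw [Finset.sum_sub_distrib, ← Finset.sum_filter, Finset.sum_const, Finset.sum_const,
    Finset.card_univ, Fintype.card_fin, nsmul_eq_mul, nsmul_eq_mul]
  linarith

theorem abs_sort_sub_vVec_le (hε : 0 < ε) (hε2 : ε ≤ 1 / 2) (hn : 6 ≤ n)
    (hN : ε⁻¹ ^ (100 * n) ≤ N) {θ : Fin n → ℝ} (hθ : ∑ i, θ i ^ 2 = 1)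
    {p : Fin N → Fin n → ℤ} (hp : ∀ i, p i ∈ points n ε)
    (hc : ∀ x ∈ points n ε, ((Finset.univ.filter fun i => p i = x).card : ℤ) = mult' N ε x)
    {y : Fin N → ℝ} (hy : ∀ i, y i = ∑ j, proj (p i) j * θ j) (i : Fin N) :
    |y (Tuple.sort y i) - vVec N n ε i| ≤ 21 * delta ε * (1 + |vVec N n ε i|) := by
  have hNpos : (0 : ℝ) < N := by exact_mod_cast i.pos
  have hd := delta_pos hε
  have hd2 := delta_le hε2
  have hq := two_le_sqrt_of_six_le hn
  have hB1 := one_le_level hε2 hn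
  have hBn := level_lt hε hn
  have hBdef : level n ε = (1 - 17 * delta ε) * √n := rfl
  set B := level n ε with hB
  set d := delta ε with hdd
  have hz : Monotone (y ∘ Tuple.sort y) := Tuple.monotone_sort y
  have hupper : ∀ t, |t| ≤ B → (N : ℝ) * (sphLaw θ).real (Set.Ioi t) < N - i →
      y (Tuple.sort y i) ≤ t + 4 * d * (1 + |t|) := by
    intro t ht h
    have h1 := card_lt_sum_proj_le hε hε2 hn hN hθ hp hc ht
    simp only [← hy, ← sphLaw_Ioi (by omega : 0 < n) θ] at h1
    refine le_of_card_gt_lt hz ?_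
    simp only [Function.comp_apply]
    rw [card_filter_comp_perm y (Tuple.sort y) fun r => t + 4 * d * (1 + |t|) < r]
    exact h1.trans_lt h
  -- The upper tail estimate for `-θ` at the level `-t`.
  have hlower : ∀ t, |t| ≤ B → (N : ℝ) * (sphLaw θ).real (Set.Iio t) < i + 1 →
      t - 4 * d * (1 + |t|) ≤ y (Tuple.sort y i) := by
    intro t ht h
    have h1 := card_lt_sum_proj_le hε hε2 hn hN (θ := fun i => -θ i) (by simpa using hθ) hp hc
      (t := -t) (by rwa [abs_neg])
    simp only [mul_neg, Finset.sum_neg_distrib, ← hy, abs_neg] at h1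
    have h2 : (gaussPi n).real {g | -t * enorm₂ g < -(√n * ∑ i, g i * θ i)}
        = (sphLaw θ).real (Set.Iio t) := by
      rw [← sphLaw_Ioi_neg, sphLaw_eq (θ := θ) (η := fun i => -θ i) (by simp),
        sphLaw_Ioi (by omega : 0 < n)]
      simp only [mul_neg, Finset.sum_neg_distrib]
    rw [h2] at h1
    refine le_of_card_lt_lt hz ?_
    simp only [Function.comp_apply]
    rw [card_filter_comp_perm y (Tuple.sort y) fun r => r < t - 4 * d * (1 + |t|)]
    refine lt_of_le_of_lt (le_of_eq ?_) (h1.trans_lt h)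
    congr 2
    ext j
    simp only [Finset.mem_filter, Finset.mem_univ, true_and]
    constructor <;> intro <;> linarith
  have hyn : |y (Tuple.sort y i)| ≤ √n := by
    rw [hy]
    exact abs_sum_proj_mul_le _ hθ
  rw [abs_le] at hyn
  have hBabs : |B| = B := abs_of_nonneg (by linarith)
  have hIio : (sphLaw θ).real (Set.Iio B) ≤ bParam n ε := by
    rw [bParam_eq, PhiN_eq (by omega) hθ]
    exact measureReal_mono Set.Iio_subset_Iic_self
  have hIioN := mul_le_mul_of_nonneg_left hIio hNpos.le
  -- Here `21 = 17 + 4`: truncation plus tail shift. In the truncated ranges only one inequality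
  -- needs it; the other is `|y| ≤ √n`.
  have hfin : B - 4 * d * (1 + B) ≥ √n - 21 * d * (1 + √n) := by
    rw [hBdef]
    nlinarith
  unfold vVec
  split_ifs with h1 h2
  · rw [abs_neg, abs_of_nonneg (Real.sqrt_nonneg _)]
    have h := hupper (-B) (by rw [abs_neg, hBabs]) (by
      rw [sphLaw_Ioi_neg]
      linarith)
    rw [abs_neg, hBabs] at h
    rw [abs_le]
    have : 0 ≤ 21 * d * (1 + √(n : ℝ)) := by positivity
    constructor <;> linarith
  · obtain ⟨hv1, hv2, hv3⟩ := PhiNInv_spec hn hθ (B := B) (q := ((i : ℝ) + 1 / 2) / N)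
      (by linarith) hBn (by
        rw [le_div_iff₀ hNpos]
        exact not_lt.1 h1) (by
        rw [div_le_iff₀ hNpos]
        exact h2)
    set v := PhiNInv n (((i : ℝ) + 1 / 2) / N)
    -- The midpoint makes both counting hypotheses strict: `N - i - 1/2 < N - i` and `i + 1/2 < i +
    -- 1`.
    have e1 : (N : ℝ) * (((i : ℝ) + 1 / 2) / N) = i + 1 / 2 := mul_div_cancel₀ _ hNpos.ne'
    have hu := hupper v hv1 (by
      have := mul_le_mul_of_nonneg_left hv2 hNpos.le
      linarith)
    have hl := hlower v hv1 (by
      have := mul_le_mul_of_nonneg_left hv3 hNpos.le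
      linarith)
    have hv0 := abs_nonneg v
    have : 4 * d * (1 + |v|) ≤ 21 * d * (1 + |v|) := by
      gcongr
      norm_num
    rw [abs_le]
    constructor <;> linarith
  · rw [abs_of_nonneg (Real.sqrt_nonneg _)]
    have h := hlower B hBabs.le (by linarith)
    rw [hBabs] at h
    rw [abs_le]
    have : 0 ≤ 21 * d * (1 + √(n : ℝ)) := by positivity
    constructor <;> linarith

end

/-! ### Norm estimates for the embedding. -/

section Main

variable {n N : ℕ} {K ε : ℝ} {X : Type*} [NormedAddCommGroup X] [NormedSpace ℝ X]
  {e : Module.Basis (Fin N) ℝ X}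

theorem abs_norm_sub_MConst_le (hε : 0 < ε) (hε2 : ε ≤ 1 / 2) (hn : 6 ≤ n)
    (hN : ε⁻¹ ^ (100 * n) ≤ N) (hN2 : 256 ≤ N) (hperm : PermInvariant e)
    (hK : IsBasisConstant e K) {T : Matrix (Fin N) (Fin n) ℝ} (hT : IsEmbeddingMatrix ε T)
    {θ : Fin n → ℝ} (hθ : ∑ i, θ i ^ 2 = 1) :
    |‖∑ i, (∑ j, T i j * θ j) • e i‖ - MConst e n ε| ≤ K * ε * MConst e n ε := by
  obtain ⟨p, hp, hc, hTp⟩ := hT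
  set y : Fin N → ℝ := fun i => ∑ j, T i j * θ j with hy
  have h1 := abs_sort_sub_vVec_le hε hε2 hn hN hθ hp hc (y := y)
    fun i => Finset.sum_congr rfl fun j _ => by rw [hTp]
  have hd := delta_pos hε
  have h2 := norm_sum_sub_le hperm hK (by norm_num : (0 : ℝ) < 1 / 33)
    (sum_max_vVec_ge hε2 hn hN2) (by positivity) h1
  rw [← hperm y (Tuple.sort y)]
  refine (abs_norm_sub_norm_le _ _).trans (h2.trans ?_)
  have hK0 : 0 ≤ K := zero_le_one.trans hK.1.1
  have hM : 0 ≤ K * MConst e n ε := mul_nonneg hK0 (norm_nonneg _)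
  change 2 * (21 * delta ε) * (1 + 1 / (1 / 33)) * (K * MConst e n ε) ≤ _
  have : ε = 1429 * delta ε := by
    unfold delta
    ring
  calc _ = 1428 * delta ε * (K * MConst e n ε) := by ring
    _ ≤ ε * (K * MConst e n ε) := by
        gcongr
        linarith
    _ = _ := by ring

theorem norm_embedding_bounds (hε : 0 < ε) (hε2 : ε ≤ 1 / 2) (hn : 6 ≤ n)
    (hN : ε⁻¹ ^ (100 * n) ≤ N) (hN2 : 256 ≤ N) (hperm : PermInvariant e)
    (hK : IsBasisConstant e K) {T : Matrix (Fin N) (Fin n) ℝ} (hT : IsEmbeddingMatrix ε T)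
    (x : Fin n → ℝ) :
    (1 - K * ε) * MConst e n ε * √(∑ j, x j ^ 2) ≤ ‖∑ i, (∑ j, T i j * x j) • e i‖ ∧
      ‖∑ i, (∑ j, T i j * x j) • e i‖ ≤ (1 + K * ε) * MConst e n ε * √(∑ j, x j ^ 2) := by
  have hS0 : 0 ≤ ∑ j, x j ^ 2 := Finset.sum_nonneg fun _ _ => sq_nonneg _
  rcases hS0.eq_or_lt with h0 | hS
  · have hx : ∀ j, x j = 0 := fun j => by
      have := (Finset.sum_eq_zero_iff_of_nonneg fun j _ => sq_nonneg (x j)).1 h0.symm j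
        (Finset.mem_univ j)
      simpa using this
    simp [hx]
  set r := √(∑ j, x j ^ 2) with hr
  have hr0 : 0 < r := Real.sqrt_pos.2 hS
  have hr2 : r ^ 2 = ∑ j, x j ^ 2 := Real.sq_sqrt hS0
  have hθ : ∑ j, (x j / r) ^ 2 = 1 := by
    simp only [div_pow]
    rw [← Finset.sum_div, ← hr2, div_self (by positivity)]
  have h1 := abs_le.1 (abs_norm_sub_MConst_le hε hε2 hn hN hN2 hperm hK hT hθ)
  have h2 : ‖∑ i, (∑ j, T i j * x j) • e i‖ = r * ‖∑ i, (∑ j, T i j * (x j / r)) • e i‖ := by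
    conv_rhs => rw [← norm_smul_of_nonneg hr0.le, Finset.smul_sum]
    congr 1
    refine Finset.sum_congr rfl fun i _ => ?_
    rw [smul_smul, Finset.mul_sum]
    congr 1
    refine Finset.sum_congr rfl fun j _ => ?_
    field_simp
  rw [h2, mul_comm _ r, mul_comm _ r]
  constructor
  · exact mul_le_mul_of_nonneg_left (by linarith) hr0.le
  · exact mul_le_mul_of_nonneg_left (by linarith) hr0.le

theorem inv_pow_le_of_le_mul_log (hε : 0 < ε) (hε2 : ε ≤ 1 / 2) (hn : 6 ≤ n)
    (hnN : (n : ℝ) ≤ 1 / 100 * (Real.log ε⁻¹)⁻¹ * Real.log N) : ε⁻¹ ^ (100 * n) ≤ N := by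
  have hy : (2 : ℝ) ≤ ε⁻¹ := by
    rw [le_inv_comm₀ two_pos hε]
    linarith
  have hlog : 0 < Real.log ε⁻¹ := Real.log_pos (by linarith)
  have hNpos : (0 : ℝ) < N := by
    rcases Nat.eq_zero_or_pos N with rfl | h
    · have : (6 : ℝ) ≤ n := by exact_mod_cast hn
      simp at hnN
      linarith
    · exact_mod_cast h
  rw [← Real.log_le_log_iff (by positivity) hNpos, Real.log_pow]
  have h1 := mul_le_mul_of_nonneg_right hnN (by positivity : 0 ≤ 100 * Real.log ε⁻¹)
  have h2 : 1 / 100 * (Real.log ε⁻¹)⁻¹ * Real.log N * (100 * Real.log ε⁻¹) = Real.log N := by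
    set l := Real.log ε⁻¹
    field_simp
  push_cast
  linarith

theorem le_of_inv_pow_le (hε : 0 < ε) (hε2 : ε ≤ 1 / 2) (hn : 6 ≤ n)
    (hN : ε⁻¹ ^ (100 * n) ≤ N) : 256 ≤ N := by
  have hy : (2 : ℝ) ≤ ε⁻¹ := by
    rw [le_inv_comm₀ two_pos hε]
    linarith
  have h1 : (256 : ℝ) ≤ N := by
    calc (256 : ℝ) = 2 ^ 8 := by norm_num
      _ ≤ 2 ^ (100 * n) := pow_le_pow_right₀ (by norm_num) (by omega)
      _ ≤ ε⁻¹ ^ (100 * n) := by gcongr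
      _ ≤ N := hN
  exact_mod_cast h1

/-- Extending a vector by zeros preserves sums against the first coordinates. -/
theorem sum_castLE_eq {M : Type*} [AddCommMonoid M] {k : ℕ} (hk : k ≤ n) (x : Fin k → ℝ)
    (f : Fin n → ℝ → M) (hf : ∀ j, f j 0 = 0) :
    ∑ j : Fin n, f j (if h : j.val < k then x ⟨j, h⟩ else 0) = ∑ j, f (Fin.castLE hk j) (x j) := by
  symm
  refine Finset.sum_of_injOn (Fin.castLE hk) (Fin.castLE_injective hk).injOn
    (fun _ _ => Finset.mem_coe.2 (Finset.mem_univ _)) (fun j _ hj => ?_) fun j _ => ?_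
  · rw [dif_neg, hf]
    intro h
    exact hj ⟨⟨j, h⟩, Finset.mem_coe.2 (Finset.mem_univ _), rfl⟩
  · rw [dif_pos (by simp)]
    rfl

end Main

end EuclideanEmbedding

end

theorem theorem1 (n N : ℕ) (K ε : ℝ) (hε : 0 < ε) (hεK : ε < (2 * K)⁻¹) (hn : 6 ≤ n)
    (hnN : (n : ℝ) ≤ 1 / 100 * (Real.log ε⁻¹)⁻¹ * Real.log N)
    {X : Type*} [NormedAddCommGroup X] [NormedSpace ℝ X] (e : Module.Basis (Fin N) ℝ X)
    (hperm : EuclideanEmbedding.PermInvariant e)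
    (hK : EuclideanEmbedding.IsBasisConstant e K) :
    (∃ T : Matrix (Fin N) (Fin n) ℝ, EuclideanEmbedding.IsEmbeddingMatrix ε T) ∧
    ∀ T : Matrix (Fin N) (Fin n) ℝ, EuclideanEmbedding.IsEmbeddingMatrix ε T →
      (∀ x : Fin n → ℝ,
        (1 - K * ε) * EuclideanEmbedding.MConst e n ε * √(∑ j, x j ^ 2)
            ≤ ‖∑ i, (∑ j, T i j * x j) • e i‖ ∧
        ‖∑ i, (∑ j, T i j * x j) • e i‖
            ≤ (1 + K * ε) * EuclideanEmbedding.MConst e n ε * √(∑ j, x j ^ 2)) ∧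
      -- the first `k` columns of `T`; with `n = 6` this covers the dimensions `k < 6`
      (∀ (k : ℕ) (hk : k ≤ n) (x : Fin k → ℝ),
        (1 - K * ε) * EuclideanEmbedding.MConst e n ε * √(∑ j, x j ^ 2)
            ≤ ‖∑ i, (∑ j, T i (Fin.castLE hk j) * x j) • e i‖ ∧
        ‖∑ i, (∑ j, T i (Fin.castLE hk j) * x j) • e i‖
            ≤ (1 + K * ε) * EuclideanEmbedding.MConst e n ε * √(∑ j, x j ^ 2)) := by
  have hK1 : 1 ≤ K := hK.1.1
  have hε2 : ε ≤ 1 / 2 := by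
    refine hεK.le.trans ?_
    rw [one_div]
    exact inv_anti₀ two_pos (by linarith)
  have hN := EuclideanEmbedding.inv_pow_le_of_le_mul_log hε hε2 hn hnN
  have hN2 := EuclideanEmbedding.le_of_inv_pow_le hε hε2 hn hN
  refine ⟨EuclideanEmbedding.exists_isEmbeddingMatrix (EuclideanEmbedding.sigma_pos hε)
    (EuclideanEmbedding.alpha_pos hε hε2).le, fun T hT => ⟨fun x =>
      EuclideanEmbedding.norm_embedding_bounds hε hε2 hn hN hN2 hperm hK hT x,
      fun k hk x => ?_⟩⟩
  have h := EuclideanEmbedding.norm_embedding_bounds hε hε2 hn hN hN2 hperm hK hT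
    fun j => if h : j.val < k then x ⟨j, h⟩ else 0
  have h1 : ∀ i, ∑ j, T i j * (if h : j.val < k then x ⟨j, h⟩ else 0)
      = ∑ j, T i (Fin.castLE hk j) * x j := fun i =>
    EuclideanEmbedding.sum_castLE_eq hk x (fun j a => T i j * a) (by simp)
  rw [EuclideanEmbedding.sum_castLE_eq hk x (fun _ a => a ^ 2) (by simp)] at h
  simp only [h1] at h
  exact h
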